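/- **Setting (LETGS).** Let $d,l\ge 1$ be integers, let $E=(\mathbb R^d)^{\{1,2,\ldots\}}$ with coordinate process $\eta=(\eta_k)_{k\ge1}$, let $\mathbb U$ be the probability on $E$ under which $\eta_1,\eta_2,\ldots$ are i.i.d. $N(0,I_d)$, let $\mathcal F_k=\sigma(\eta_1,\ldots,\eta_k)$ with $\mathcal F_0$ trivial, let $\Lambda=(\Lambda_k)_{k\ge0}$ be an $(\mathcal F_k)$-adapted process of real $d\times l$ matrices, $\tau$ a stopping time of $(\mathcal F_k)_{k\ge 0}$ with values in $\{0,1,2,\ldots,\infty\}$, $Z$ a real-valued $\mathcal F_\tau$-measurable random variable, and $\epsilon>0$. For $b\in\mathbb R^l$ put $\lambda_k(b)=\Lambda_k b$, and let $\mathbb V(b)$ be the unique probability on $E$ with density $\gamma_n(b)=\prod_{k=0}^{n-1}\exp(-\frac12|\lambda_k(b)|^2+\lambda_k(b)^T\eta_{k+1})$ with respect to $\mathbb U$ on $\mathcal F_n$ for each $n\ge 0$. Let $\mathbb Q_1$ and $\mathbb Q(b)$ be the restrictions of $\mathbb U$ and $\mathbb V(b)$ to $\mathcal F_\tau$, $$L(b)=\mathbb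 1(\tau<\infty)\exp\Big(\sum_{k=0}^{\tau-1}\big(\tfrac12|\lambda_k(b)|^2-\lambda_k(b)^T\eta_{k+1}\big)\Big)+\epsilon\,\mathbb 1(\tau=\infty),\qquad G=\mathbb 1(\tau<\infty)\,\tfrac12\sum_{k=0}^{\tau-1}\Lambda_k^T\Lambda_k .$$ The mean square is $\mathrm{msq}(b)=\mathbb E_{\mathbb Q(b)}((ZL(b))^2)\in[0,\infty]$, and its well-known estimators are, for $n\ge1$, $b',b\in\mathbb R^l$ and $\omega=(\omega_1,\ldots,\omega_n)\in E^n$, $$\widehat{\mathrm{msq}}_n(b',b)(\omega)=\frac1n\sum_{i=1}^n Z(\omega_i)^2L(b')(\omega_i)L(b)(\omega_i).$$ For $b\in\mathbb R^l$ let $A_b$ be the event that $Z\ne0$, $0<\tau<\infty$, and $\lambda_k(b)\neq0$ for some $k<\tau$. The *linear independence condition* (C) is: $\mathbb Q_1(A_b)>0$ for each $b\ne0$. The condition $r_n$ holds for $\omega\in E^n$ if for each $b\neq0$ there is an $i$ with $\omega_i\in A_b$. The *integrability condition* (I) is: the essential supremum under $\mathbb U$ of $\mathbb 1(Z\neq0)\mathbb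 1(0<\tau<\infty)\max(\|\Lambda_0\|,\ldots,\|\Lambda_{\tau-1}\|)$ (Euclidean operator norms) is finite, and for some integer $s\ge1$ we have $\mathbb 1(Z\ne0)\tau\le s$ everywhere and $\mathbb E_{\mathbb U}(Z^2\exp(\sum_{i=1}^s\theta_i^T\eta_i))<\infty$ for all $\theta_1,\ldots,\theta_s\in\mathbb R^d$. A function $f:\mathbb R^l\to\mathbb R$ is called strongly convex with a constant $m>0$ if it is twice differentiable and $v^T\nabla^2f(b)v\ge m|v|^2$ for all $b,v\in\mathbb R^l$; it is called strongly convex if this holds for some $m>0$. **Theorem.** 1. Suppose that (I) and (C) hold. Then $2GZ^2\exp(-\frac12\sum_{i=1}^\tau|\eta_i|^2)$ (equal to $0$ on $\tau=\infty$) has $\mathbb Q_1$-integrable entries, the matrix $$M=\mathbb E_{\mathbb Q_1}\Big(2GZ^2\exp\big(-\tfrac12\sum_{i=1}^\tau|\eta_i|^2\big)\Big)$$ is positive definite, $\mathrm{msq}$ is finite and twice differentiable on $\mathbb R^l$, and $\nabla^2\mathrm{msq}(b)-M$ is positive semidefinite for each $b\in\mathbb R^l$. In particular, $\mathrm{msq}$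 is strongly convex with a constant equal to the lowest eigenvalue of $M$, and it has a unique minimum point. 2. Let $n\ge1$, $b'\in\mathbb R^l$, $\omega\in E^n$, and $f(b)=\widehat{\mathrm{msq}}_n(b',b)(\omega)$. Then $f$ is convex on $\mathbb R^l$. If $r_n(\omega)$ holds, then $f$ is strongly convex. If $r_n(\omega)$ does not hold, then there exists $b\neq0$ such that $f(a+tb)=f(a)$ for all $a\in\mathbb R^l$, $t\in\mathbb R$. 3. Suppose that $\mathbb Q_1(Z\ne0,\ \tau=\infty)=0$ and $\mathbb Q(b)(Z\neq0,\ \tau=\infty)=0$ for each $b\in\mathbb R^l$. If $\mathrm{msq}(b_0)<\infty$ for some $b_0$, then the set $B=\{\mathrm{msq}<\infty\}$ is nonempty and convex and $\mathrm{msq}$ is convex on $B$; if moreover (C) holds, then $\mathrm{msq}$ is lower semicontinuous, $\mathrm{msq}(b)\to\infty$ as $|b|\to\infty$, $\mathrm{msq}$ is strictly convex on $B$, and $\mathrm{msq}$ has a unique minimum point, at which it is finite. If (C) does not hold (whether or not $\mathrm{msq}$ is finite anywhere), then there exists $b\ne0$ such that $\mathrm{msq}(a+tb)=\mathrm{msq}(a)$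 for all $a\in\mathbb R^l$, $t\in\mathbb R$. -/

import Mathlib

open MeasureTheory ProbabilityTheory Set Filter Topology
open scoped ENNReal RealInnerProductSpace Matrix

namespace LETGS

/-- Infinite sequences of vectors of `ℝ^d`. The coordinate `x k` is the `(k+1)`-st member
`η_{k+1}` of the coordinate process. -/
abbrev SeqSpace (d : ℕ) : Type := ℕ → EuclideanSpace ℝ (Fin d)

/-- The law `𝕌` on sequences under which the coordinates are i.i.d. `N(0, I_d)`. -/
noncomputable def gaussianSeq (d : ℕ) : Measure (SeqSpace d) :=
  Measure.infinitePi fun _ : ℕ => stdGaussian (EuclideanSpace ℝ (Fin d))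

/-- The natural filtration: `𝓕_k = σ(η_1, …, η_k)`, and `𝓕_0` is trivial. -/
def pathFiltration (d : ℕ) :
    Filtration ℕ (inferInstance : MeasurableSpace (SeqSpace d)) where
  seq k := MeasurableSpace.comap (fun (x : SeqSpace d) (i : Fin k) => x i) inferInstance
  mono' := by
    intro m n hmn
    have h : (fun (x : SeqSpace d) (i : Fin m) => x i) =
        (fun (y : Fin n → EuclideanSpace ℝ (Fin d)) (i : Fin m) => y (Fin.castLE hmn i)) ∘
          (fun (x : SeqSpace d) (i : Fin n) => x i) := rfl
    change MeasurableSpace.comap _ _ ≤ MeasurableSpace.comap _ _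
    rw [h, ← MeasurableSpace.comap_comp]
    exact MeasurableSpace.comap_mono
      (measurable_iff_comap_le.1 (measurable_pi_lambda _ fun i => measurable_pi_apply _))
  le' := by
    intro k
    exact measurable_iff_comap_le.1 (measurable_pi_lambda _ fun i => measurable_pi_apply _)

/-- The data of linearly parametrized exponential tilting for Gaussian stopped sequences:
an adapted process `Λ` of `d × l` matrices, a stopping time `τ` (possibly infinite), a real random
variable `Z` measurable with respect to `𝓕_τ`, and the positive value `ε` which the density takes
on `τ = ∞`. -/
structure Setting (d l : ℕ) where
  Λ : ℕ → SeqSpace d → Matrix (Fin d) (Fin l) ℝ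
  adapted : ∀ k i j, Measurable[pathFiltration d k] fun x => Λ k x i j
  τ : SeqSpace d → WithTop ℕ
  isStoppingTime : IsStoppingTime (pathFiltration d) τ
  Z : SeqSpace d → ℝ
  measurable_Z : Measurable[isStoppingTime.measurableSpace] Z
  ε : ℝ
  ε_pos : 0 < ε

namespace Setting

variable {d l : ℕ} (S : Setting d l)

/-- The tilting process `λ_k(b) = Λ_k b`. -/
noncomputable def tilt (b : EuclideanSpace ℝ (Fin l)) (k : ℕ) (x : SeqSpace d) :
    EuclideanSpace ℝ (Fin d) :=
  (S.Λ k x).toEuclideanLin b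

/-- The value of `τ` as a natural number; used only where `τ < ∞`. -/
def len (x : SeqSpace d) : ℕ := (S.τ x).untopD 0

/-- The density process
`γ_n(b) = ∏_{k < n} exp(-|λ_k(b)|² / 2 + λ_k(b)ᵀ η_{k+1})` of the tilted law. -/
noncomputable def γ (b : EuclideanSpace ℝ (Fin l)) (n : ℕ) (x : SeqSpace d) : ℝ :=
  ∏ k ∈ Finset.range n, Real.exp (-(1 / 2) * ‖S.tilt b k x‖ ^ 2 + ⟪S.tilt b k x, x k⟫)

/-- The first `n` coordinates of `x` are replaced, one after another, by
`x_k + λ_k(b)`, where `λ_k(b)` is evaluated at the coordinates replaced so far. -/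
noncomputable def shiftStage (b : EuclideanSpace ℝ (Fin l)) : ℕ → SeqSpace d → SeqSpace d
  | 0, x => x
  | n + 1, x =>
      Function.update (shiftStage b n x) n (x n + S.tilt b n (shiftStage b n x))

/-- The sequence `y` solving `y_k = x_k + λ_k(b)(y)` for every `k`. -/
noncomputable def tiltedPath (b : EuclideanSpace ℝ (Fin l)) (x : SeqSpace d) : SeqSpace d :=
  fun n => S.shiftStage b (n + 1) x n

/-- The tilted law `𝕍(b)`: the law of `tiltedPath b` under `𝕌`. By `V_apply` below it is
the probability whose density with respect to `𝕌` on `𝓕_n` is `γ_n(b)`, for every `n`.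
The importance sampling distribution `ℚ(b)` is the restriction of `𝕍(b)` to `𝓕_τ`, and `ℚ₁` is
that of `𝕌`. Only `𝓕_τ`-measurable quantities are integrated against them, so `𝕍(b)` and `𝕌`
are used in their place. -/
noncomputable def V (b : EuclideanSpace ℝ (Fin l)) : Measure (SeqSpace d) :=
  (gaussianSeq d).map (S.tiltedPath b)

end Setting

lemma gaussianReal_shift_pdf (v z : ℝ) :
    gaussianPDF v 1 z =
      gaussianPDF 0 1 z * ENNReal.ofReal (Real.exp (-(1 / 2) * v ^ 2 + v * z)) := by
  rw [gaussianPDF, gaussianPDF, ← ENNReal.ofReal_mul (gaussianPDFReal_nonneg _ _ _)]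
  congr 1
  rw [gaussianPDFReal, gaussianPDFReal]
  rw [mul_assoc _ (Real.exp _) (Real.exp _), ← Real.exp_add]
  congr 2
  simp only [NNReal.coe_one]
  ring

/-- A translation of the standard one-dimensional Gaussian law has the exponential density. -/
lemma gaussianReal_withDensity (v : ℝ) :
    (gaussianReal 0 1).withDensity
      (fun z => ENNReal.ofReal (Real.exp (-(1 / 2) * v ^ 2 + v * z))) = gaussianReal v 1 := by
  rw [gaussianReal_of_var_ne_zero _ one_ne_zero, gaussianReal_of_var_ne_zero _ one_ne_zero,
    ← withDensity_mul _ (by fun_prop) (by fun_prop)]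
  congr 1
  funext z
  rw [gaussianReal_shift_pdf]
  rfl

/-- Translation of the standard Gaussian law on `ℝ^d`. -/
lemma lintegral_stdGaussian_add {d : ℕ} (v : EuclideanSpace ℝ (Fin d))
    {f : EuclideanSpace ℝ (Fin d) → ℝ≥0∞} (hf : Measurable f) :
    ∫⁻ z, f (z + v) ∂(stdGaussian (EuclideanSpace ℝ (Fin d))) =
      ∫⁻ z, ENNReal.ofReal (Real.exp (-(1 / 2) * ‖v‖ ^ 2 + ⟪v, z⟫)) * f z
        ∂(stdGaussian (EuclideanSpace ℝ (Fin d))) := by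
  have key : (Measure.pi (fun _ : Fin d => gaussianReal 0 1)).map (fun z => z + v.ofLp) =
      (Measure.pi (fun _ : Fin d => gaussianReal 0 1)).withDensity
        (fun z => ∏ i, ENNReal.ofReal (Real.exp (-(1 / 2) * v i ^ 2 + v i * z i))) := by
    have h1 : (Measure.pi (fun _ : Fin d => gaussianReal 0 1)).map (fun z => z + v.ofLp) =
        Measure.pi (fun i : Fin d => gaussianReal (v i) 1) := by
      have := Measure.pi_map_pi (μ := fun _ : Fin d => gaussianReal 0 1)
        (f := fun i z => z + v i) (fun i => by fun_prop)
      rw [show (fun z : Fin d → ℝ => z + v.ofLp) = fun z i => z i + v i from rfl, this]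
      congr 1
      funext i
      rw [gaussianReal_map_add_const, zero_add]
    rw [h1]
    refine Measure.pi_eq fun s hs => ?_
    rw [withDensity_apply _ (MeasurableSet.univ_pi hs), ← lintegral_indicator
      (MeasurableSet.univ_pi hs)]
    have h2 : ∀ z : Fin d → ℝ, (Set.univ.pi s).indicator
        (fun z => ∏ i, ENNReal.ofReal (Real.exp (-(1 / 2) * v i ^ 2 + v i * z i))) z =
        ∏ i, (s i).indicator
          (fun y => ENNReal.ofReal (Real.exp (-(1 / 2) * v i ^ 2 + v i * y))) (z i) := by
      intro z
      by_cases hz : z ∈ Set.univ.pi s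
      · rw [Set.indicator_of_mem hz]
        refine Finset.prod_congr rfl fun i _ => ?_
        rw [Set.indicator_of_mem (hz i (Set.mem_univ i))]
      · rw [Set.indicator_of_notMem hz]
        simp only [Set.mem_pi, Set.mem_univ, forall_const, not_forall] at hz
        obtain ⟨i, hi⟩ := hz
        exact (Finset.prod_eq_zero (Finset.mem_univ i) (Set.indicator_of_notMem hi _)).symm
    simp_rw [h2]
    have hm : ∀ i, Measurable ((s i).indicator
        (fun y : ℝ => ENNReal.ofReal (Real.exp (-(1 / 2) * v i ^ 2 + v i * y)))) := by
      intro i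
      exact Measurable.indicator (by fun_prop) (hs i)
    have hind := iIndepFun_pi (μ := fun _ : Fin d => gaussianReal 0 1)
      (X := fun i => (s i).indicator
        (fun y : ℝ => ENNReal.ofReal (Real.exp (-(1 / 2) * v i ^ 2 + v i * y))))
      (fun i => (hm i).aemeasurable)
    rw [lintegral_prod_eq_prod_lintegral_of_indepFun Finset.univ _ hind
      (fun i => (hm i).comp (measurable_pi_apply i))]
    refine Finset.prod_congr rfl fun i _ => ?_
    rw [(measurePreserving_eval (fun _ : Fin d => gaussianReal 0 1) i).lintegral_comp (hm i),
      lintegral_indicator (hs i), ← withDensity_apply _ (hs i), gaussianReal_withDensity]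
  rw [← map_pi_eq_stdGaussian, lintegral_map (by fun_prop) (by fun_prop),
    lintegral_map (by fun_prop) (by fun_prop)]
  have h3 : ∫⁻ z, f (WithLp.toLp 2 z)
      ∂((Measure.pi (fun _ : Fin d => gaussianReal 0 1)).map (fun z => z + v.ofLp)) =
      ∫⁻ z, f (WithLp.toLp 2 z + v) ∂(Measure.pi (fun _ : Fin d => gaussianReal 0 1)) := by
    rw [lintegral_map (by fun_prop) (by fun_prop)]
    rfl
  rw [← h3, key, lintegral_withDensity_eq_lintegral_mul _ (by fun_prop) (by fun_prop)]
  refine lintegral_congr fun z => ?_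
  simp only [Pi.mul_apply]
  congr 1
  rw [← ENNReal.ofReal_prod_of_nonneg (fun i _ => (Real.exp_pos _).le), ← Real.exp_sum]
  congr 2
  rw [Finset.sum_add_distrib, ← Finset.mul_sum, EuclideanSpace.norm_sq_eq]
  simp [PiLp.inner_apply, mul_comm]

instance isProbabilityMeasure_gaussianSeq (d : ℕ) : IsProbabilityMeasure (gaussianSeq d) := by
  unfold gaussianSeq; infer_instance

/-- Resampling one coordinate preserves the law of the sequence. -/
lemma map_update_gaussianSeq (d n : ℕ) :
    ((stdGaussian (EuclideanSpace ℝ (Fin d))).prod (gaussianSeq d)).map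
      (fun p => Function.update p.2 n p.1) = gaussianSeq d := by
  have hmeas : Measurable fun p : EuclideanSpace ℝ (Fin d) × SeqSpace d =>
      Function.update p.2 n p.1 := by
    refine measurable_pi_lambda _ fun i => ?_
    by_cases h : i = n
    · subst h
      simpa using measurable_fst
    · simp only [Function.update_of_ne h]
      exact (measurable_pi_apply i).comp measurable_snd
  refine Measure.eq_infinitePi _ fun s t ht => ?_
  rw [Measure.map_apply hmeas (MeasurableSet.pi s.countable_toSet fun i _ => ht i)]
  have hpre : (fun p : EuclideanSpace ℝ (Fin d) × SeqSpace d => Function.update p.2 n p.1) ⁻¹'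
      Set.pi s t = (if n ∈ s then t n else Set.univ) ×ˢ Set.pi (s.erase n) t := by
    ext ⟨z, x⟩
    simp only [Set.mem_preimage, Set.mem_pi, Set.mem_prod, Finset.mem_coe, Finset.mem_erase]
    constructor
    · intro h
      refine ⟨?_, fun i hi => ?_⟩
      · split_ifs with hn
        · simpa using h n hn
        · trivial
      · simpa [Function.update_of_ne hi.1] using h i hi.2
    · rintro ⟨h1, h2⟩ i hi
      by_cases hin : i = n
      · subst hin
        simpa [hi] using h1
      · simpa [Function.update_of_ne hin] using h2 i ⟨hin, hi⟩
  rw [hpre, Measure.prod_prod, gaussianSeq, Measure.infinitePi_pi _ (fun i _ => ht i)]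
  split_ifs with hn
  · exact Finset.mul_prod_erase s (fun i => stdGaussian (EuclideanSpace ℝ (Fin d)) (t i)) hn
  · rw [measure_univ, one_mul, Finset.erase_eq_of_notMem hn]

namespace Setting

variable {d l : ℕ} (S : Setting d l)

lemma tilt_congr (b : EuclideanSpace ℝ (Fin l)) {k : ℕ} {x y : SeqSpace d}
    (h : ∀ i < k, x i = y i) : S.tilt b k x = S.tilt b k y := by
  have hΛ : S.Λ k x = S.Λ k y := by
    ext i j
    obtain ⟨t, -, ht⟩ := S.adapted k i j (measurableSet_singleton (S.Λ k y i j))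
    have hxy : (fun i : Fin k => x i) = fun i : Fin k => y i := funext fun i => h i i.2
    have hy : y ∈ (fun (x : SeqSpace d) (i : Fin k) => x i) ⁻¹' t := by rw [ht]; rfl
    have hx : x ∈ (fun (x : SeqSpace d) (i : Fin k) => x i) ⁻¹' t := by
      simp only [Set.mem_preimage] at hy ⊢
      rw [hxy]; exact hy
    rw [ht] at hx
    exact hx
  rw [tilt, tilt, hΛ]

@[fun_prop]
lemma measurable_tilt (b : EuclideanSpace ℝ (Fin l)) (k : ℕ) : Measurable (S.tilt b k) := by
  have h : ∀ i j, Measurable fun x => S.Λ k x i j :=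
    fun i j => (S.adapted k i j).mono ((pathFiltration d).le k) le_rfl
  have h2 : S.tilt b k = fun x => WithLp.toLp 2 fun i => ∑ j, S.Λ k x i j * b j := by
    funext x
    rfl
  rw [h2]
  exact (WithLp.measurable_toLp 2 _).comp (measurable_pi_lambda _ fun i =>
    Finset.measurable_sum _ fun j _ => (h i j).mul_const _)

lemma measurable_γ (b : EuclideanSpace ℝ (Fin l)) (n : ℕ) : Measurable (S.γ b n) := by
  unfold γ
  fun_prop

lemma γ_congr (b : EuclideanSpace ℝ (Fin l)) {n : ℕ} {x y : SeqSpace d}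
    (h : ∀ i < n, x i = y i) : S.γ b n x = S.γ b n y := by
  refine Finset.prod_congr rfl fun k hk => ?_
  have hk' := Finset.mem_range.1 hk
  rw [S.tilt_congr b (fun i hi => h i (hi.trans hk')), h k hk']

lemma γ_pos (b : EuclideanSpace ℝ (Fin l)) (n : ℕ) (x : SeqSpace d) : 0 < S.γ b n x :=
  Finset.prod_pos fun _ _ => Real.exp_pos _

lemma measurable_update_tilt (b : EuclideanSpace ℝ (Fin l)) (n : ℕ) :
    Measurable fun x : SeqSpace d => Function.update x n (x n + S.tilt b n x) := by
  refine measurable_pi_lambda _ fun i => ?_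
  by_cases h : i = n
  · subst h
    simp only [Function.update_self]
    fun_prop
  · simp only [Function.update_of_ne h]
    fun_prop

lemma lintegral_update_tilt (b : EuclideanSpace ℝ (Fin l)) (n : ℕ) {F : SeqSpace d → ℝ≥0∞}
    (hF : Measurable F) :
    ∫⁻ x, F (Function.update x n (x n + S.tilt b n x)) ∂(gaussianSeq d) =
      ∫⁻ x, ENNReal.ofReal (Real.exp (-(1 / 2) * ‖S.tilt b n x‖ ^ 2 + ⟪S.tilt b n x, x n⟫)) * F x
        ∂(gaussianSeq d) := by
  have hup : Measurable fun p : EuclideanSpace ℝ (Fin d) × SeqSpace d =>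
      Function.update p.2 n p.1 := by
    refine measurable_pi_lambda _ fun i => ?_
    by_cases h : i = n
    · subst h
      simpa using measurable_fst
    · simp only [Function.update_of_ne h]
      exact (measurable_pi_apply i).comp measurable_snd
  have ht : ∀ (x : SeqSpace d) (z : EuclideanSpace ℝ (Fin d)),
      S.tilt b n (Function.update x n z) = S.tilt b n x := fun x z =>
    S.tilt_congr b fun i hi => Function.update_of_ne hi.ne _ _
  have hF1 : Measurable fun x => F (Function.update x n (x n + S.tilt b n x)) :=
    hF.comp (S.measurable_update_tilt b n)
  have hF2 : Measurable fun x : SeqSpace d => ENNReal.ofReal (Real.exp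
      (-(1 / 2) * ‖S.tilt b n x‖ ^ 2 + ⟪S.tilt b n x, x n⟫)) * F x := by
    fun_prop
  calc ∫⁻ x, F (Function.update x n (x n + S.tilt b n x)) ∂(gaussianSeq d)
      = ∫⁻ x, F (Function.update x n (x n + S.tilt b n x))
          ∂(((stdGaussian (EuclideanSpace ℝ (Fin d))).prod (gaussianSeq d)).map
            (fun p => Function.update p.2 n p.1)) := by rw [map_update_gaussianSeq]
    _ = ∫⁻ x, ∫⁻ z, F (Function.update x n (z + S.tilt b n x))
          ∂(stdGaussian (EuclideanSpace ℝ (Fin d))) ∂(gaussianSeq d) := by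
        rw [lintegral_map hF1 hup]
        refine (lintegral_prod_symm _ (hF1.comp hup).aemeasurable).trans ?_
        simp only [Function.comp_apply, ht, Function.update_self, Function.update_idem]
    _ = ∫⁻ x, ∫⁻ z, ENNReal.ofReal (Real.exp (-(1 / 2) * ‖S.tilt b n x‖ ^ 2
            + ⟪S.tilt b n x, z⟫)) * F (Function.update x n z)
          ∂(stdGaussian (EuclideanSpace ℝ (Fin d))) ∂(gaussianSeq d) := by
        refine lintegral_congr fun x => ?_
        exact lintegral_stdGaussian_add (S.tilt b n x) (f := fun z => F (Function.update x n z))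
          (hF.comp (measurable_update x))
    _ = ∫⁻ x, ENNReal.ofReal (Real.exp (-(1 / 2) * ‖S.tilt b n x‖ ^ 2
            + ⟪S.tilt b n x, x n⟫)) * F x
          ∂(((stdGaussian (EuclideanSpace ℝ (Fin d))).prod (gaussianSeq d)).map
            (fun p => Function.update p.2 n p.1)) := by
        rw [lintegral_map hF2 hup]
        refine Eq.trans ?_ (lintegral_prod_symm _ (hF2.comp hup).aemeasurable).symm
        simp only [Function.comp_apply, ht, Function.update_self]
    _ = _ := by rw [map_update_gaussianSeq]

lemma shiftStage_of_le (b : EuclideanSpace ℝ (Fin l)) (x : SeqSpace d) {n i : ℕ} (h : n ≤ i) :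
    S.shiftStage b n x i = x i := by
  induction n with
  | zero => rfl
  | succ n ih =>
    rw [shiftStage, Function.update_of_ne (by omega), ih (by omega)]

lemma shiftStage_succ (b : EuclideanSpace ℝ (Fin l)) (x : SeqSpace d) (n : ℕ) :
    S.shiftStage b (n + 1) x = Function.update (S.shiftStage b n x) n
      (S.shiftStage b n x n + S.tilt b n (S.shiftStage b n x)) := by
  rw [shiftStage, S.shiftStage_of_le b x le_rfl]

lemma shiftStage_of_lt (b : EuclideanSpace ℝ (Fin l)) (x : SeqSpace d) {n i : ℕ} (h : i < n) :
    S.shiftStage b n x i = S.tiltedPath b x i := by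
  induction n with
  | zero => omega
  | succ n ih =>
    rcases Nat.lt_succ_iff_lt_or_eq.1 h with h' | rfl
    · rw [shiftStage, Function.update_of_ne h'.ne, ih h']
    · rfl

/-- `tiltedPath b x` solves `y_n = x_n + λ_n(b)(y)`. -/
lemma tiltedPath_apply (b : EuclideanSpace ℝ (Fin l)) (x : SeqSpace d) (n : ℕ) :
    S.tiltedPath b x n = x n + S.tilt b n (S.tiltedPath b x) := by
  rw [tiltedPath, shiftStage, Function.update_self]
  congr 1
  exact S.tilt_congr b fun i hi => S.shiftStage_of_lt b x hi

lemma measurable_shiftStage (b : EuclideanSpace ℝ (Fin l)) (n : ℕ) :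
    Measurable (S.shiftStage b n) := by
  induction n with
  | zero => exact measurable_id
  | succ n ih =>
    have : S.shiftStage b (n + 1) = (fun x : SeqSpace d => Function.update x n
        (x n + S.tilt b n x)) ∘ S.shiftStage b n := funext fun x => S.shiftStage_succ b x n
    rw [this]
    exact (S.measurable_update_tilt b n).comp ih

lemma measurable_tiltedPath (b : EuclideanSpace ℝ (Fin l)) : Measurable (S.tiltedPath b) :=
  measurable_pi_lambda _ fun n => (measurable_pi_apply n).comp (S.measurable_shiftStage b (n + 1))

instance isProbabilityMeasure_V (b : EuclideanSpace ℝ (Fin l)) : IsProbabilityMeasure (S.V b) :=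
  Measure.isProbabilityMeasure_map (S.measurable_tiltedPath b).aemeasurable

lemma lintegral_shiftStage (b : EuclideanSpace ℝ (Fin l)) (n : ℕ) {F : SeqSpace d → ℝ≥0∞}
    (hF : Measurable F) :
    ∫⁻ x, F (S.shiftStage b n x) ∂(gaussianSeq d) =
      ∫⁻ x, ENNReal.ofReal (S.γ b n x) * F x ∂(gaussianSeq d) := by
  induction n generalizing F with
  | zero => simp [shiftStage, γ]
  | succ n ih =>
    simp only [S.shiftStage_succ]
    rw [ih (F := fun x => F (Function.update x n (x n + S.tilt b n x)))
      (hF.comp (S.measurable_update_tilt b n))]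
    have hγ := S.measurable_γ b n
    have h := S.lintegral_update_tilt b n (F := fun x => ENNReal.ofReal (S.γ b n x) * F x)
      (by fun_prop)
    have hinv : ∀ x : SeqSpace d, S.γ b n (Function.update x n (x n + S.tilt b n x)) = S.γ b n x :=
      fun x => S.γ_congr b fun i hi => Function.update_of_ne hi.ne _ _
    simp only [hinv] at h
    rw [h]
    refine lintegral_congr fun x => ?_
    rw [← mul_assoc, ← ENNReal.ofReal_mul (Real.exp_pos _).le, γ, γ, Finset.prod_range_succ,
      mul_comm (Real.exp _)]

/-- The law `𝕍(b)` has density `γ_n(b)` with respect to `𝕌` on `𝓕_n`, for every `n`. -/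
theorem V_apply (b : EuclideanSpace ℝ (Fin l)) (n : ℕ) {B : Set (SeqSpace d)}
    (hB : MeasurableSet[pathFiltration d n] B) :
    S.V b B = ∫⁻ x in B, ENNReal.ofReal (S.γ b n x) ∂(gaussianSeq d) := by
  have hB' : MeasurableSet B := (pathFiltration d).le n B hB
  have hpre : S.tiltedPath b ⁻¹' B = S.shiftStage b n ⁻¹' B := by
    obtain ⟨t, -, rfl⟩ := hB
    ext x
    simp only [Set.mem_preimage]
    rw [show (fun i : Fin n => S.tiltedPath b x i) = fun i : Fin n => S.shiftStage b n x i from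
      funext fun i => (S.shiftStage_of_lt b x i.2).symm]
  rw [V, Measure.map_apply (S.measurable_tiltedPath b) hB', hpre,
    ← lintegral_indicator_one (S.measurable_shiftStage b n hB'),
    ← lintegral_indicator hB']
  have h := S.lintegral_shiftStage b n (F := B.indicator 1) (measurable_one.indicator hB')
  refine Eq.trans ?_ (h.trans ?_)
  · rfl
  · refine lintegral_congr fun x => ?_
    by_cases hx : x ∈ B <;> simp [hx]

end Setting

namespace Setting

variable {d l : ℕ} (S : Setting d l)

/-- The density `L(b) = 1(τ < ∞) / γ_τ(b) + ε 1(τ = ∞)`. -/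
noncomputable def L (b : EuclideanSpace ℝ (Fin l)) (x : SeqSpace d) : ℝ :=
  if S.τ x = ⊤ then S.ε else
    Real.exp (∑ k ∈ Finset.range (S.len x),
      ((1 / 2) * ‖S.tilt b k x‖ ^ 2 - ⟪S.tilt b k x, x k⟫))

/-- `G = 1(τ < ∞) (1/2) ∑_{k < τ} Λ_kᵀ Λ_k`. -/
noncomputable def G (x : SeqSpace d) : Matrix (Fin l) (Fin l) ℝ :=
  if S.τ x = ⊤ then 0 else
    (1 / 2 : ℝ) • ∑ k ∈ Finset.range (S.len x), (S.Λ k x)ᵀ * S.Λ k x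

/-- The mean square `E_{ℚ(b)}((Z L(b))²) ∈ [0, ∞]` of the importance sampling estimator. -/
noncomputable def msq (b : EuclideanSpace ℝ (Fin l)) : ℝ≥0∞ :=
  ∫⁻ x, ENNReal.ofReal ((S.Z x * S.L b x) ^ 2) ∂(S.V b)

/-- The well-known mean square estimator `(1/n) ∑ᵢ (Z² L(b') L(b))(ωᵢ)`. -/
noncomputable def msqEst (n : ℕ) (b' b : EuclideanSpace ℝ (Fin l)) (ω : Fin n → SeqSpace d) : ℝ :=
  (1 / (n : ℝ)) * ∑ i, S.Z (ω i) ^ 2 * S.L b' (ω i) * S.L b (ω i)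

/-- The event `A_b`: `Z ≠ 0`, `0 < τ < ∞`, and `λ_k(b) ≠ 0` for some `k < τ`. -/
def A (b : EuclideanSpace ℝ (Fin l)) : Set (SeqSpace d) :=
  {x | S.Z x ≠ 0 ∧ 0 < S.τ x ∧ S.τ x < ⊤ ∧ ∃ k : ℕ, (k : WithTop ℕ) < S.τ x ∧ S.tilt b k x ≠ 0}

/-- The linear independence condition: `ℚ₁(A_b) > 0` for each `b ≠ 0`. -/
def LinIndepCond : Prop :=
  ∀ b : EuclideanSpace ℝ (Fin l), b ≠ 0 → 0 < gaussianSeq d (S.A b)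

/-- The random condition `r_n` on samples: for each `b ≠ 0` some `A_b(ωᵢ)` holds. -/
def r (n : ℕ) (ω : Fin n → SeqSpace d) : Prop :=
  ∀ b : EuclideanSpace ℝ (Fin l), b ≠ 0 → ∃ i, ω i ∈ S.A b

/-- `Z` vanishes almost surely on `τ = ∞`, under `ℚ₁` and under each `ℚ(b)`. -/
def ZeroAtInfinity : Prop :=
  gaussianSeq d {x | S.Z x ≠ 0 ∧ S.τ x = ⊤} = 0 ∧
    ∀ b, S.V b {x | S.Z x ≠ 0 ∧ S.τ x = ⊤} = 0

/-- The integrability condition with horizon `s` for a random variable `Y`: the essential supremum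
over `𝕌` of `1(Y ≠ 0) 1(0 < τ < ∞) max(‖Λ_0‖, …, ‖Λ_{τ-1}‖)` (Euclidean operator norms) is finite,
`1(Y ≠ 0) τ ≤ s`, and `|Y| exp(∑_{i ≤ s} θ_iᵀ η_i)` is `𝕌`-integrable
for all `θ_1, …, θ_s ∈ ℝ^d`. -/
def IntegrabilityCond (Y : SeqSpace d → ℝ) (s : ℕ) : Prop :=
  0 < s ∧
  essSup (fun x => ⨆ (k : ℕ) (_ : Y x ≠ 0 ∧ S.τ x < ⊤ ∧ (k : WithTop ℕ) < S.τ x),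
      ‖(S.Λ k x).toEuclideanLin.toContinuousLinearMap‖ₑ) (gaussianSeq d) < ⊤ ∧
  (∀ x, Y x ≠ 0 → S.τ x ≤ s) ∧
  ∀ θ : Fin s → EuclideanSpace ℝ (Fin d),
    ∫⁻ x, ENNReal.ofReal (|Y x| * Real.exp (∑ i, ⟪θ i, x i⟫)) ∂(gaussianSeq d) < ⊤

/-- The integrand `2 G Z² exp(-(1/2) ∑_{i ≤ τ} |η_i|²)`; it vanishes on `τ = ∞`, as `G` does. -/
noncomputable def lowerIntegrand (x : SeqSpace d) : Matrix (Fin l) (Fin l) ℝ :=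
  (2 * S.Z x ^ 2 * Real.exp (-(1 / 2) * ∑ k ∈ Finset.range (S.len x), ‖x k‖ ^ 2)) • S.G x

/-- The matrix `M = E_{ℚ₁}(2 G Z² exp(-(1/2) ∑_{i ≤ τ} |η_i|²))`. -/
noncomputable def M : Matrix (Fin l) (Fin l) ℝ :=
  Matrix.of fun i j => ∫ x, S.lowerIntegrand x i j ∂(gaussianSeq d)

end Setting

/-- The Hessian matrix `∇²f(b)`. -/
noncomputable def hessian {l : ℕ} (f : EuclideanSpace ℝ (Fin l) → ℝ)
    (b : EuclideanSpace ℝ (Fin l)) : Matrix (Fin l) (Fin l) ℝ :=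
  Matrix.of fun i j =>
    fderiv ℝ (fderiv ℝ f) b (EuclideanSpace.single i 1) (EuclideanSpace.single j 1)

/-- Twice (Fréchet) differentiable on `ℝ^l`. -/
def TwiceDifferentiable {l : ℕ} (f : EuclideanSpace ℝ (Fin l) → ℝ) : Prop :=
  Differentiable ℝ f ∧ Differentiable ℝ (fderiv ℝ f)

/-- Strong convexity on `ℝ^l` with constant `m > 0`: `f` is twice differentiable and
`vᵀ ∇²f(b) v ≥ m |v|²` for all `b, v`. -/
def StronglyConvexWith {l : ℕ} (m : ℝ) (f : EuclideanSpace ℝ (Fin l) → ℝ) : Prop :=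
  0 < m ∧ TwiceDifferentiable f ∧
    ∀ b v : EuclideanSpace ℝ (Fin l), m * ‖v‖ ^ 2 ≤ v.ofLp ⬝ᵥ (hessian f b *ᵥ v.ofLp)

/-- The set on which an extended-valued function is finite. -/
def finiteSet {l : ℕ} (f : EuclideanSpace ℝ (Fin l) → ℝ≥0∞) : Set (EuclideanSpace ℝ (Fin l)) :=
  {b | f b < ⊤}

/-- `f : ℝ^l → [0, ∞]` is lower semicontinuous, tends to `∞` as `|b| → ∞`, and is strictly convex
on the set on which it is finite, which is nonempty and convex. -/
def StrictCond {l : ℕ} (f : EuclideanSpace ℝ (Fin l) → ℝ≥0∞) : Prop :=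
  LowerSemicontinuous f ∧
  Tendsto f (Bornology.cobounded _) (𝓝 ⊤) ∧
  (finiteSet f).Nonempty ∧
  Convex ℝ (finiteSet f) ∧
  StrictConvexOn ℝ (finiteSet f) fun b => (f b).toReal

end LETGS

open LETGS

/-!
For a path with `τ < ∞` the logarithm of the density `L(b)` is a quadratic function of `b`,
`log L(b) = bᵀ G b - hᵀ b` with `h = ∑_{k < τ} Λ_kᵀ η_{k+1}` (`LETGS.Setting.L_eq`). Since `2 G` is
positive semidefinite, `L(b)` is convex in `b`; it is strictly convex in the direction of `v` if
`vᵀ G v > 0`, and constant in that direction if `vᵀ G v = 0`. The event `A_v` consists of the paths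
with `Z ≠ 0`, `τ < ∞` and `vᵀ G v > 0` (`LETGS.Setting.mem_A_iff`), so the linear independence
condition and the condition `r_n` say that no direction is degenerate on all relevant paths.

The mean square becomes an integral with respect to the law `𝕌`, which does not depend on `b`: on
`τ = n` everything is a function of the first `n` coordinates, on which `𝕍(b)` has the density
`γ_n(b) = 1 / L(b)`, and this cancels one of the two factors `L(b)`. If `Z` vanishes almost surely
on `τ = ∞`, then `msq(b) = E_𝕌(1(τ < ∞) Z² L(b))` (`LETGS.Setting.msq_eq`). Convexity, strict
convexity and invariance along a direction pass from the integrand to the integral, and Fatou's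
lemma gives lower semicontinuity. For coercivity, `log L(b) ≥ bᵀ G b / 2 - ∑_{i ≤ τ} |η_i|²` and
`exp u ≥ u` bound `msq` from below by a quadratic form with values in `[0, ∞]`, which is lower
semicontinuous and positive on the unit sphere, hence bounded away from zero there
(`LETGS.Setting.tendsto_msq`).

For the Hessian, the second derivative of `exp (bᵀ G b - hᵀ b)` is
`exp (bᵀ G b - hᵀ b) (2 G + (2 G b - h) (2 G b - h)ᵀ)`. Dropping the rank one term and completing
the square, `log L(b) ≥ -∑_{i ≤ τ} |η_i|² / 2` (`LETGS.Setting.neg_energy_le_quad`), bounds it from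
below by the integrand of `M`. The two differentiations under the integral sign are carried out once
for integrals `∫ w exp (quad A h b)` with respect to any measure
(`ExpQuadDominated.hasFDerivAt_integral`, `ExpQuadDominated.hasFDerivAt_integral_deriv`); the mean
square is the case of the law `𝕌`, and the mean square estimator that of the counting measure on the
sample. A positive definite lower bound of the Hessian yields strong convexity with its lowest
eigenvalue as a constant (`exists_stronglyConvexWith`).
-/

/-! ### Exponentials of quadratic functions -/

section ExpQuad

set_option maxSynthPendingDepth 3

variable {E : Type*} [NormedAddCommGroup E] [InnerProductSpace ℝ E]

/-- The quadratic function `b ↦ ⟪A b, b⟫ / 2 - ⟪h, b⟫`. -/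
noncomputable def quad (A : E →L[ℝ] E) (h b : E) : ℝ := 2⁻¹ * ⟪A b, b⟫ - ⟪h, b⟫

/-- The derivative at `b` of `exp (quad A h)`, for symmetric `A`. -/
noncomputable def expQuadDeriv (A : E →L[ℝ] E) (h b : E) : E →L[ℝ] ℝ :=
  Real.exp (quad A h b) • innerSL ℝ (A b - h)

/-- The second derivative at `b` of `exp (quad A h)`, for symmetric `A`. -/
noncomputable def expQuadDeriv₂ (A : E →L[ℝ] E) (h b : E) : E →L[ℝ] E →L[ℝ] ℝ :=
  Real.exp (quad A h b) • (innerSL ℝ ∘L A) +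
    (expQuadDeriv A h b).smulRight (innerSL ℝ (A b - h))

lemma expQuadDeriv₂_apply (A : E →L[ℝ] E) (h b u v : E) :
    expQuadDeriv₂ A h b u v =
      Real.exp (quad A h b) * (⟪A u, v⟫ + ⟪A b - h, u⟫ * ⟪A b - h, v⟫) := by
  change Real.exp (quad A h b) * ⟪A u, v⟫ +
    (Real.exp (quad A h b) * ⟪A b - h, u⟫) * ⟪A b - h, v⟫ = _
  ring

lemma hasFDerivAt_exp_quad {A : E →L[ℝ] E} (hA : ∀ u v, ⟪A u, v⟫ = ⟪A v, u⟫) (h b : E) :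
    HasFDerivAt (fun b => Real.exp (quad A h b)) (expQuadDeriv A h b) b := by
  have hq : HasFDerivAt (quad A h) (innerSL ℝ (A b - h)) b := by
    have h1 := ((A.hasFDerivAt (x := b)).inner ℝ (hasFDerivAt_id b)).const_mul (2⁻¹ : ℝ)
    have h2 := (innerSL ℝ h).hasFDerivAt (x := b)
    refine (h1.sub h2).congr_fderiv ?_
    ext v
    have := hA v b
    simp at this ⊢
    linarith
  exact hq.exp

lemma hasFDerivAt_expQuadDeriv {A : E →L[ℝ] E} (hA : ∀ u v, ⟪A u, v⟫ = ⟪A v, u⟫) (h b : E) :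
    HasFDerivAt (expQuadDeriv A h) (expQuadDeriv₂ A h b) b := by
  have h1 : HasFDerivAt (fun b => innerSL ℝ (A b - h)) (innerSL ℝ ∘L A) b :=
    (innerSL ℝ).hasFDerivAt.comp b ((A.hasFDerivAt (x := b)).sub_const h)
  exact (hasFDerivAt_exp_quad hA h b).smul h1

lemma continuous_quad : Continuous fun p : (E →L[ℝ] E) × E × E => quad p.1 p.2.1 p.2.2 := by
  unfold quad
  fun_prop

lemma continuous_expQuadDeriv :
    Continuous fun p : (E →L[ℝ] E) × E × E => expQuadDeriv p.1 p.2.1 p.2.2 := by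
  unfold expQuadDeriv
  have := continuous_quad (E := E)
  fun_prop

lemma continuous_expQuadDeriv₂ :
    Continuous fun p : (E →L[ℝ] E) × E × E => expQuadDeriv₂ p.1 p.2.1 p.2.2 := by
  unfold expQuadDeriv₂
  have h0 := continuous_quad (E := E)
  have h1 := continuous_expQuadDeriv (E := E)
  have h2 : Continuous fun p : (E →L[ℝ] E) × E × E => innerSL ℝ (p.1 p.2.2 - p.2.1) := by
    fun_prop
  have h3 : Continuous fun p : (E →L[ℝ] E) × E × E => (innerSL ℝ ∘L p.1 : E →L[ℝ] E →L[ℝ] ℝ) :=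
    (continuous_const.clm_comp continuous_fst)
  refine (h0.rexp.smul h3).add ?_
  exact (ContinuousLinearMap.smulRightL ℝ E (E →L[ℝ] ℝ)).continuous₂.comp (h1.prodMk h2)

lemma abs_quad_le {A : E →L[ℝ] E} {h b : E} {C R : ℝ} (hA : ‖A‖ ≤ C) (hb : ‖b‖ ≤ R) :
    |quad A h b| ≤ C * R ^ 2 + R * ‖h‖ := by
  have hC : 0 ≤ C := (norm_nonneg _).trans hA
  have hR : 0 ≤ R := (norm_nonneg _).trans hb
  have h1 : |⟪A b, b⟫| ≤ C * R ^ 2 := by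
    calc |⟪A b, b⟫| ≤ ‖A b‖ * ‖b‖ := abs_real_inner_le_norm _ _
      _ ≤ (C * R) * R := by
        gcongr
        exact A.le_of_opNorm_le_of_le hA hb
      _ = _ := by ring
  have h2 : |⟪h, b⟫| ≤ R * ‖h‖ := by
    rw [mul_comm]
    exact (abs_real_inner_le_norm _ _).trans (by gcongr)
  have h3 : 0 ≤ C * R ^ 2 := by positivity
  rw [quad, abs_le] at *
  constructor <;> linarith [h1.1, h1.2, h2.1, h2.2]

lemma norm_map_sub_le {A : E →L[ℝ] E} {h b : E} {C R : ℝ} (hA : ‖A‖ ≤ C) (hb : ‖b‖ ≤ R) :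
    ‖A b - h‖ ≤ C * R + ‖h‖ :=
  (norm_sub_le _ _).trans (add_le_add_left (A.le_of_opNorm_le_of_le hA hb) _)

lemma norm_expQuadDeriv_le {A : E →L[ℝ] E} {h b : E} {C R : ℝ} (hA : ‖A‖ ≤ C) (hb : ‖b‖ ≤ R) :
    ‖expQuadDeriv A h b‖ ≤ Real.exp (C * R ^ 2 + C * R) * Real.exp ((R + 1) * ‖h‖) := by
  rw [expQuadDeriv, norm_smul, innerSL_apply_norm, Real.norm_eq_abs, Real.abs_exp, ← Real.exp_add]
  have h1 := (le_abs_self _).trans (abs_quad_le (h := h) hA hb)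
  have h2 := norm_map_sub_le (h := h) hA hb
  have h3 := Real.add_one_le_exp (C * R + ‖h‖)
  calc _ ≤ Real.exp (C * R ^ 2 + R * ‖h‖) * Real.exp (C * R + ‖h‖) := by
        gcongr
        linarith
    _ = _ := by rw [← Real.exp_add]; ring_nf

lemma norm_expQuadDeriv₂_le {A : E →L[ℝ] E} {h b : E} {C R : ℝ} (hA : ‖A‖ ≤ C) (hb : ‖b‖ ≤ R) :
    ‖expQuadDeriv₂ A h b‖ ≤
      ((C + 1) * Real.exp (C * R ^ 2 + 2 * (C * R))) * Real.exp ((R + 2) * ‖h‖) := by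
  have hC : 0 ≤ C := (norm_nonneg _).trans hA
  have hR : 0 ≤ R := (norm_nonneg _).trans hb
  have h1 := (le_abs_self _).trans (abs_quad_le (h := h) hA hb)
  have h2 := norm_map_sub_le (h := h) hA hb
  have h3 := Real.add_one_le_exp (C * R + ‖h‖)
  have h4 : ‖(innerSL ℝ ∘L A : E →L[ℝ] E →L[ℝ] ℝ)‖ ≤ C := by
    refine (ContinuousLinearMap.opNorm_le_bound _ (norm_nonneg A) fun v => ?_).trans hA
    rw [ContinuousLinearMap.comp_apply, innerSL_apply_norm]
    exact A.le_opNorm v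
  have h5 : 1 ≤ Real.exp (2 * (C * R + ‖h‖)) := Real.one_le_exp (by positivity)
  have h6 : ‖A b - h‖ * ‖A b - h‖ ≤ Real.exp (2 * (C * R + ‖h‖)) := by
    rw [two_mul, Real.exp_add]
    gcongr <;> linarith
  calc ‖expQuadDeriv₂ A h b‖
      ≤ Real.exp (quad A h b) * C + Real.exp (quad A h b) * (‖A b - h‖ * ‖A b - h‖) := by
        refine (norm_add_le _ _).trans (add_le_add ?_ ?_)
        · rw [norm_smul, Real.norm_eq_abs, Real.abs_exp]
          gcongr
        · rw [ContinuousLinearMap.norm_smulRight_apply, expQuadDeriv, norm_smul,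
            innerSL_apply_norm, Real.norm_eq_abs, Real.abs_exp, mul_assoc]
    _ = Real.exp (quad A h b) * (C + ‖A b - h‖ * ‖A b - h‖) := by ring
    _ ≤ Real.exp (C * R ^ 2 + R * ‖h‖) * ((C + 1) * Real.exp (2 * (C * R + ‖h‖))) := by
        gcongr
        nlinarith
    _ = (C + 1) * (Real.exp (C * R ^ 2 + R * ‖h‖) * Real.exp (2 * (C * R + ‖h‖))) := by ring
    _ = (C + 1) * (Real.exp (C * R ^ 2 + 2 * (C * R)) * Real.exp ((R + 2) * ‖h‖)) := by
        rw [← Real.exp_add, ← Real.exp_add]; ring_nf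
    _ = _ := by ring

/-- Along a segment, `quad` falls below its chord by a multiple of `⟪A (u - v), u - v⟫`. -/
lemma quad_combo {A : E →L[ℝ] E} (hA : ∀ u v, ⟪A u, v⟫ = ⟪A v, u⟫) (h u v : E) {s t : ℝ}
    (hst : s + t = 1) :
    quad A h (s • u + t • v) =
      s * quad A h u + t * quad A h v - 2⁻¹ * (s * t * ⟪A (u - v), u - v⟫) := by
  obtain rfl : t = 1 - s := by linarith
  have := hA u v
  simp only [quad, map_add, map_sub, map_smul, inner_add_left, inner_add_right, inner_sub_left,
    inner_sub_right, inner_smul_left, inner_smul_right, conj_trivial]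
  rw [this]
  ring

lemma exp_quad_combo_le {A : E →L[ℝ] E} (hA : ∀ u v, ⟪A u, v⟫ = ⟪A v, u⟫)
    (hpos : ∀ v, 0 ≤ ⟪A v, v⟫) (h u v : E) {s t : ℝ} (hs : 0 ≤ s) (ht : 0 ≤ t) (hst : s + t = 1) :
    Real.exp (quad A h (s • u + t • v)) ≤
      s * Real.exp (quad A h u) + t * Real.exp (quad A h v) := by
  have h1 := convexOn_exp.2 (mem_univ (quad A h u)) (mem_univ (quad A h v)) hs ht hst
  refine le_trans (Real.exp_le_exp.2 ?_) h1
  rw [quad_combo hA h u v hst]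
  have := mul_nonneg (mul_nonneg hs ht) (hpos (u - v))
  simp only [smul_eq_mul]
  linarith

lemma exp_quad_combo_lt {A : E →L[ℝ] E} (hA : ∀ u v, ⟪A u, v⟫ = ⟪A v, u⟫)
    (h u v : E) (hpos : 0 < ⟪A (u - v), u - v⟫) {s t : ℝ} (hs : 0 < s) (ht : 0 < t)
    (hst : s + t = 1) :
    Real.exp (quad A h (s • u + t • v)) <
      s * Real.exp (quad A h u) + t * Real.exp (quad A h v) := by
  have h1 := convexOn_exp.2 (mem_univ (quad A h u)) (mem_univ (quad A h v)) hs.le ht.le hst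
  refine lt_of_lt_of_le (Real.exp_lt_exp.2 ?_) h1
  rw [quad_combo hA h u v hst]
  have := mul_pos (mul_pos hs ht) hpos
  simp only [smul_eq_mul]
  linarith

end ExpQuad

/-! ### Differentiation under the integral sign -/

section IntegralExpQuad

set_option maxSynthPendingDepth 3

lemma norm_le_of_mem_ball {E : Type*} [SeminormedAddCommGroup E] {b₀ b : E}
    (hb : b ∈ Metric.ball b₀ 1) : ‖b‖ ≤ ‖b₀‖ + 1 := by
  have h1 : ‖b - b₀‖ < 1 := by simpa [dist_eq_norm] using hb
  have := norm_le_norm_add_norm_sub' b b₀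
  linarith

variable {E : Type*} [NormedAddCommGroup E] [InnerProductSpace ℝ E]
  {X : Type*} [MeasurableSpace X] {μ : Measure X} {w : X → ℝ} {A : X → E →L[ℝ] E} {h : X → E}

/-- The conditions under which `b ↦ ∫ w exp (quad A h b)` may be differentiated twice under the
integral sign: `A` is symmetric, bounded where the weight `w` does not vanish, and `w` integrates
all exponentials of `‖h‖`. -/
structure ExpQuadDominated (μ : Measure X) (w : X → ℝ) (A : X → E →L[ℝ] E) (h : X → E) (C : ℝ) :
    Prop where
  aesm_A : AEStronglyMeasurable A μ
  aesm_h : AEStronglyMeasurable h μ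
  symm : ∀ x u v, ⟪A x u, v⟫ = ⟪A x v, u⟫
  bound : ∀ᵐ x ∂μ, w x ≠ 0 → ‖A x‖ ≤ C
  integrable : ∀ R : ℝ, Integrable (fun x => w x * Real.exp (R * ‖h x‖)) μ

namespace ExpQuadDominated

variable {C : ℝ} (D : ExpQuadDominated μ w A h C)
include D

lemma aesm_w : AEStronglyMeasurable w μ := by
  simpa using (D.integrable 0).aestronglyMeasurable

lemma aesm_comp {F : Type*} [NormedAddCommGroup F] [NormedSpace ℝ F]
    {φ : (E →L[ℝ] E) × E × E → F} (hφ : Continuous φ) (b : E) :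
    AEStronglyMeasurable (fun x => w x • φ (A x, h x, b)) μ :=
  D.aesm_w.smul (hφ.comp_aestronglyMeasurable
    (D.aesm_A.prodMk (D.aesm_h.prodMk aestronglyMeasurable_const)))

/-- Bounds of `φ` by an exponential of `‖h‖`, uniform for `‖b‖ ≤ R`, give an integrable bound of
`w φ (A, h, b)` which does not depend on `b`. -/
lemma norm_smul_le {F : Type*} [NormedAddCommGroup F] [NormedSpace ℝ F]
    {φ : (E →L[ℝ] E) × E × E → F} {K R ρ : ℝ}
    (hφ : ∀ A h b, ‖A‖ ≤ C → ‖b‖ ≤ R → ‖φ (A, h, b)‖ ≤ K * Real.exp (ρ * ‖h‖)) :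
    ∀ᵐ x ∂μ, ∀ b, ‖b‖ ≤ R →
      ‖w x • φ (A x, h x, b)‖ ≤ K * ‖w x * Real.exp (ρ * ‖h x‖)‖ := by
  filter_upwards [D.bound] with x hx b hb
  rw [norm_smul, norm_mul, Real.norm_eq_abs (Real.exp _), Real.abs_exp]
  by_cases hw : w x = 0
  · simp [hw]
  · calc _ ≤ ‖w x‖ * (K * Real.exp (ρ * ‖h x‖)) := by
          gcongr
          exact hφ _ _ _ (hx hw) hb
      _ = _ := by ring

lemma integrable_smul {F : Type*} [NormedAddCommGroup F] [NormedSpace ℝ F]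
    {φ : (E →L[ℝ] E) × E × E → F} (hc : Continuous φ) {K R ρ : ℝ}
    (hφ : ∀ A h b, ‖A‖ ≤ C → ‖b‖ ≤ R → ‖φ (A, h, b)‖ ≤ K * Real.exp (ρ * ‖h‖))
    {b : E} (hb : ‖b‖ ≤ R) :
    Integrable (fun x => w x • φ (A x, h x, b)) μ := by
  refine ((D.integrable ρ).norm.const_mul K).mono' (D.aesm_comp hc b) ?_
  filter_upwards [D.norm_smul_le hφ] with x hx using hx b hb

lemma integrable_exp (b : E) : Integrable (fun x => w x * Real.exp (quad (A x) (h x) b)) μ := by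
  refine D.integrable_smul (φ := fun p => Real.exp (quad p.1 p.2.1 p.2.2)) continuous_quad.rexp
    (K := Real.exp (C * ‖b‖ ^ 2)) (R := ‖b‖) (ρ := ‖b‖) ?_ le_rfl
  intro A h b' hA hb'
  rw [Real.norm_eq_abs, Real.abs_exp, ← Real.exp_add]
  exact Real.exp_le_exp.2 ((le_abs_self _).trans (abs_quad_le hA hb'))

lemma integrable_deriv (b : E) : Integrable (fun x => w x • expQuadDeriv (A x) (h x) b) μ :=
  D.integrable_smul (φ := fun p => expQuadDeriv p.1 p.2.1 p.2.2) continuous_expQuadDeriv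
    (fun _ _ _ hA hb => norm_expQuadDeriv_le hA hb) le_rfl

lemma integrable_deriv₂ (b : E) : Integrable (fun x => w x • expQuadDeriv₂ (A x) (h x) b) μ :=
  D.integrable_smul (φ := fun p => expQuadDeriv₂ p.1 p.2.1 p.2.2) continuous_expQuadDeriv₂
    (fun _ _ _ hA hb => norm_expQuadDeriv₂_le hA hb) le_rfl

lemma hasFDerivAt_integral (b : E) :
    HasFDerivAt (fun b => ∫ x, w x * Real.exp (quad (A x) (h x) b) ∂μ)
      (∫ x, w x • expQuadDeriv (A x) (h x) b ∂μ) b := by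
  have key := D.norm_smul_le (φ := fun p => expQuadDeriv p.1 p.2.1 p.2.2) (R := ‖b‖ + 1)
    (fun _ _ _ hA hb => norm_expQuadDeriv_le hA hb)
  refine hasFDerivAt_integral_of_dominated_of_fderiv_le
    (F' := fun b x => w x • expQuadDeriv (A x) (h x) b) (Metric.ball_mem_nhds b one_pos)
    (.of_forall fun b => (D.integrable_exp b).aestronglyMeasurable) (D.integrable_exp b)
    (D.integrable_deriv b).aestronglyMeasurable
    (key.mono fun x hx b' hb' => hx b' (norm_le_of_mem_ball hb'))
    ((D.integrable _).norm.const_mul _) ?_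
  exact .of_forall fun x b' _ => (hasFDerivAt_exp_quad (D.symm x) (h x) b').const_mul (w x)

lemma hasFDerivAt_integral_deriv (b : E) :
    HasFDerivAt (fun b => ∫ x, w x • expQuadDeriv (A x) (h x) b ∂μ)
      (∫ x, w x • expQuadDeriv₂ (A x) (h x) b ∂μ) b := by
  have key := D.norm_smul_le (φ := fun p => expQuadDeriv₂ p.1 p.2.1 p.2.2) (R := ‖b‖ + 1)
    (fun _ _ _ hA hb => norm_expQuadDeriv₂_le hA hb)
  refine hasFDerivAt_integral_of_dominated_of_fderiv_le
    (F' := fun b x => w x • expQuadDeriv₂ (A x) (h x) b) (Metric.ball_mem_nhds b one_pos)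
    (.of_forall fun b => (D.integrable_deriv b).aestronglyMeasurable) (D.integrable_deriv b)
    (D.integrable_deriv₂ b).aestronglyMeasurable
    (key.mono fun x hx b' hb' => hx b' (norm_le_of_mem_ball hb'))
    ((D.integrable _).norm.const_mul _) ?_
  exact .of_forall fun x b' _ => (hasFDerivAt_expQuadDeriv (D.symm x) (h x) b').const_smul (w x)

lemma fderiv_integral : fderiv ℝ (fun b => ∫ x, w x * Real.exp (quad (A x) (h x) b) ∂μ) =
    fun b => ∫ x, w x • expQuadDeriv (A x) (h x) b ∂μ :=
  funext fun b => (D.hasFDerivAt_integral b).fderiv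

lemma integrable_deriv₂_apply (b u v : E) :
    Integrable (fun x => w x * expQuadDeriv₂ (A x) (h x) b u v) μ :=
  ((D.integrable_deriv₂ b).apply_continuousLinearMap u).apply_continuousLinearMap v

lemma fderiv_fderiv_integral_apply (b u v : E) :
    fderiv ℝ (fderiv ℝ fun b => ∫ x, w x * Real.exp (quad (A x) (h x) b) ∂μ) b u v =
      ∫ x, w x * expQuadDeriv₂ (A x) (h x) b u v ∂μ := by
  rw [D.fderiv_integral, (D.hasFDerivAt_integral_deriv b).fderiv,
    ContinuousLinearMap.integral_apply (D.integrable_deriv₂ b),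
    ContinuousLinearMap.integral_apply ((D.integrable_deriv₂ b).apply_continuousLinearMap u)]
  rfl

end ExpQuadDominated

end IntegralExpQuad

/-! ### Hessian matrices and strong convexity -/

section Hessian

set_option maxSynthPendingDepth 3

variable {l : ℕ}

lemma dotProduct_hessian_mulVec (f : EuclideanSpace ℝ (Fin l) → ℝ)
    (b u v : EuclideanSpace ℝ (Fin l)) :
    u.ofLp ⬝ᵥ (hessian f b *ᵥ v.ofLp) = fderiv ℝ (fderiv ℝ f) b u v := by
  have hsum : ∀ w : EuclideanSpace ℝ (Fin l),
      w = ∑ i, w i • (EuclideanSpace.single i 1 : EuclideanSpace ℝ (Fin l)) := fun w => by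
    ext j
    simp [Pi.single_apply]
  conv_rhs => rw [hsum u, hsum v]
  simp only [map_sum, map_smul, sum_apply, smul_apply, dotProduct, Matrix.mulVec, hessian,
    Matrix.of_apply, smul_eq_mul, Finset.mul_sum]
  refine Finset.sum_comm.trans (Finset.sum_congr rfl fun j _ => Finset.sum_congr rfl fun i _ => ?_)
  ring

lemma dotProduct_integral_mulVec {X : Type*} [MeasurableSpace X] {μ : Measure X}
    {F : X → Matrix (Fin l) (Fin l) ℝ} (hF : ∀ i j, Integrable (fun x => F x i j) μ)
    (v : Fin l → ℝ) :
    v ⬝ᵥ ((Matrix.of fun i j => ∫ x, F x i j ∂μ) *ᵥ v) = ∫ x, v ⬝ᵥ (F x *ᵥ v) ∂μ := by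
  simp only [dotProduct, Matrix.mulVec, Matrix.of_apply, Finset.mul_sum]
  rw [integral_finsetSum _ fun i _ => integrable_finsetSum _ fun j _ =>
    ((hF i j).mul_const _).const_mul _]
  refine Finset.sum_congr rfl fun i _ => ?_
  rw [integral_finsetSum _ fun j _ => ((hF i j).mul_const _).const_mul _]
  refine Finset.sum_congr rfl fun j _ => ?_
  rw [integral_const_mul, integral_mul_const]

lemma Matrix.PosDef.exists_isLeast_spectrum [NeZero l] {N : Matrix (Fin l) (Fin l) ℝ}
    (hN : N.PosDef) :
    ∃ m, IsLeast (spectrum ℝ N) m ∧ 0 < m ∧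
      ∀ v : EuclideanSpace ℝ (Fin l), m * ‖v‖ ^ 2 ≤ v.ofLp ⬝ᵥ (N *ᵥ v.ofLp) := by
  obtain ⟨i, -, hi⟩ := Finset.exists_min_image Finset.univ hN.1.eigenvalues Finset.univ_nonempty
  have hle : IsLeast (spectrum ℝ N) (hN.1.eigenvalues i) := by
    rw [hN.1.spectrum_real_eq_range_eigenvalues]
    exact ⟨mem_range_self i, by rintro _ ⟨j, rfl⟩; exact hi j (Finset.mem_univ j)⟩
  refine ⟨_, hle, hN.eigenvalues_pos i, fun v => ?_⟩
  set m := hN.1.eigenvalues i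
  have hpsd : (N - algebraMap ℝ _ m).PosSemidef := by
    rw [Matrix.posSemidef_iff_isHermitian_and_spectrum_nonneg]
    refine ⟨hN.1.sub ?_, fun a ha => ?_⟩
    · rw [Matrix.algebraMap_eq_diagonal]
      exact Matrix.isHermitian_diagonal _
    · rw [← spectrum.sub_singleton_eq] at ha
      obtain ⟨c, hc, _, rfl, rfl⟩ := Set.mem_sub.1 ha
      exact sub_nonneg.2 (hle.2 hc)
  have h1 := hpsd.dotProduct_mulVec_nonneg v.ofLp
  rw [Matrix.sub_mulVec, dotProduct_sub, Algebra.algebraMap_eq_smul_one, Matrix.smul_mulVec,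
    Matrix.one_mulVec, dotProduct_smul] at h1
  have h2 : v.ofLp ⬝ᵥ v.ofLp = ‖v‖ ^ 2 := by
    rw [EuclideanSpace.norm_sq_eq]
    simp [dotProduct, sq]
  simp only [star_trivial, smul_eq_mul, h2] at h1
  linarith

/-- A function whose Hessian dominates a positive definite matrix `N` is strongly convex, with the
lowest eigenvalue of `N` as a constant. -/
lemma exists_stronglyConvexWith [NeZero l] {N : Matrix (Fin l) (Fin l) ℝ} (hN : N.PosDef)
    {f : EuclideanSpace ℝ (Fin l) → ℝ} (hf : TwiceDifferentiable f)
    (hle : ∀ b, (hessian f b - N).PosSemidef) :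
    ∃ m, IsLeast (spectrum ℝ N) m ∧ StronglyConvexWith m f := by
  obtain ⟨m, hm, hpos, h⟩ := hN.exists_isLeast_spectrum
  refine ⟨m, hm, hpos, hf, fun b v => (h v).trans ?_⟩
  have := (hle b).dotProduct_mulVec_nonneg v.ofLp
  rw [Matrix.sub_mulVec, dotProduct_sub, star_trivial] at this
  linarith

namespace ExpQuadDominated

variable {X : Type*} [MeasurableSpace X] {μ : Measure X} {w : X → ℝ}
  {A : X → EuclideanSpace ℝ (Fin l) →L[ℝ] EuclideanSpace ℝ (Fin l)}
  {h : X → EuclideanSpace ℝ (Fin l)} {C : ℝ} (D : ExpQuadDominated μ w A h C)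
include D

lemma twiceDifferentiable :
    TwiceDifferentiable fun b => ∫ x, w x * Real.exp (quad (A x) (h x) b) ∂μ := by
  refine ⟨fun b => (D.hasFDerivAt_integral b).differentiableAt, ?_⟩
  rw [D.fderiv_integral]
  exact fun b => (D.hasFDerivAt_integral_deriv b).differentiableAt

/-- A lower bound `-g` of the exponents, uniform in `b`, turns into a lower bound of the Hessian:
in `exp (quad A h b) (A + (A b - h) (A b - h)ᵀ)` the rank one term is dropped. -/
lemma posSemidef_hessian_sub (hw : ∀ x, 0 ≤ w x) (hA : ∀ x v, 0 ≤ ⟪A x v, v⟫)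
    {g : X → ℝ} (hg : ∀ x b, -g x ≤ quad (A x) (h x) b)
    {N : Matrix (Fin l) (Fin l) ℝ} (hN : N.IsHermitian)
    (hle : ∀ v : EuclideanSpace ℝ (Fin l), v.ofLp ⬝ᵥ (N *ᵥ v.ofLp) ≤
      ∫ x, w x * (Real.exp (-g x) * ⟪A x v, v⟫) ∂μ) (b : EuclideanSpace ℝ (Fin l)) :
    (hessian (fun b => ∫ x, w x * Real.exp (quad (A x) (h x) b) ∂μ) b - N).PosSemidef := by
  refine .of_dotProduct_mulVec_nonneg (Matrix.IsHermitian.sub ?_ hN) fun v => ?_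
  · ext i j
    simp only [Matrix.conjTranspose_apply, star_trivial, hessian, Matrix.of_apply,
      D.fderiv_fderiv_integral_apply]
    refine integral_congr_ae (.of_forall fun x => ?_)
    simp only [expQuadDeriv₂_apply]
    rw [D.symm x]
    ring
  · have h1 := dotProduct_hessian_mulVec
      (fun b => ∫ x, w x * Real.exp (quad (A x) (h x) b) ∂μ) b (WithLp.toLp 2 v) (WithLp.toLp 2 v)
    rw [D.fderiv_fderiv_integral_apply] at h1
    have h2 := hle (WithLp.toLp 2 v)
    rw [star_trivial, Matrix.sub_mulVec, dotProduct_sub, sub_nonneg]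
    refine h2.trans (le_trans ?_ h1.ge)
    refine integral_mono_of_nonneg (.of_forall fun x => ?_) (D.integrable_deriv₂_apply b _ _)
      (.of_forall fun x => ?_)
    · exact mul_nonneg (hw x) (mul_nonneg (Real.exp_pos _).le (hA x _))
    · refine mul_le_mul_of_nonneg_left ?_ (hw x)
      rw [expQuadDeriv₂_apply]
      have h3 := mul_self_nonneg ⟪A x b - h x, WithLp.toLp 2 v⟫
      have h4 := hA x (WithLp.toLp 2 v)
      have h5 := hg x b
      gcongr
      linarith

end ExpQuadDominated

end Hessian

/-! ### The density as the exponential of a quadratic function -/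

namespace LETGS.Setting

variable {d l : ℕ} (S : Setting d l)

/-- The quadratic coefficient `2 G` of `log L`, as an operator. -/
noncomputable def curv (x : SeqSpace d) :
    EuclideanSpace ℝ (Fin l) →L[ℝ] EuclideanSpace ℝ (Fin l) :=
  Matrix.toEuclideanCLM (𝕜 := ℝ) ((2 : ℝ) • S.G x)

/-- The linear coefficient `∑_{k < τ} Λ_kᵀ η_{k+1}` of `-log L`, set to `0` on `τ = ∞`. -/
noncomputable def drift (x : SeqSpace d) : EuclideanSpace ℝ (Fin l) :=
  if S.τ x = ⊤ then 0 else
    ∑ k ∈ Finset.range (S.len x), (S.Λ k x)ᵀ.toEuclideanLin (x k)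

/-- The sum `∑_{k ≤ τ} |η_k|²`, which is `0` on `τ = ∞`. -/
noncomputable def energy (x : SeqSpace d) : ℝ := ∑ k ∈ Finset.range (S.len x), ‖x k‖ ^ 2

lemma energy_nonneg (x : SeqSpace d) : 0 ≤ S.energy x := Finset.sum_nonneg fun _ _ => by positivity

lemma coe_len {x : SeqSpace d} (hx : S.τ x ≠ ⊤) : (S.len x : WithTop ℕ) = S.τ x := by
  obtain ⟨n, hn⟩ := WithTop.ne_top_iff_exists.1 hx
  rw [len, ← hn]
  rfl

lemma len_of_top {x : SeqSpace d} (hx : S.τ x = ⊤) : S.len x = 0 := by simp [len, hx]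

lemma curv_of_top {x : SeqSpace d} (hx : S.τ x = ⊤) : S.curv x = 0 := by simp [curv, G, hx]

lemma drift_of_top {x : SeqSpace d} (hx : S.τ x = ⊤) : S.drift x = 0 := by simp [drift, hx]

lemma inner_curv_eq_dotProduct (x : SeqSpace d) (u v : EuclideanSpace ℝ (Fin l)) :
    ⟪S.curv x u, v⟫ = v.ofLp ⬝ᵥ (((2 : ℝ) • S.G x) *ᵥ u.ofLp) := by
  rw [real_inner_comm, curv, Matrix.inner_toEuclideanCLM]

lemma inner_tilt_tilt (x : SeqSpace d) (k : ℕ) (u v : EuclideanSpace ℝ (Fin l)) :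
    ⟪S.tilt u k x, S.tilt v k x⟫ = v.ofLp ⬝ᵥ (((S.Λ k x)ᵀ * S.Λ k x) *ᵥ u.ofLp) := by
  rw [← Matrix.mulVec_mulVec, Matrix.dotProduct_mulVec, Matrix.vecMul_transpose,
    EuclideanSpace.inner_eq_star_dotProduct]
  rfl

lemma inner_curv {x : SeqSpace d} (hx : S.τ x ≠ ⊤) (u v : EuclideanSpace ℝ (Fin l)) :
    ⟪S.curv x u, v⟫ = ∑ k ∈ Finset.range (S.len x), ⟪S.tilt u k x, S.tilt v k x⟫ := by
  rw [inner_curv_eq_dotProduct, G, if_neg hx, smul_smul]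
  norm_num
  rw [Matrix.sum_mulVec, dotProduct_sum]
  simp only [inner_tilt_tilt]

lemma inner_curv_self {x : SeqSpace d} (hx : S.τ x ≠ ⊤) (v : EuclideanSpace ℝ (Fin l)) :
    ⟪S.curv x v, v⟫ = ∑ k ∈ Finset.range (S.len x), ‖S.tilt v k x‖ ^ 2 := by
  simp only [S.inner_curv hx, real_inner_self_eq_norm_sq]

lemma inner_drift {x : SeqSpace d} (hx : S.τ x ≠ ⊤) (b : EuclideanSpace ℝ (Fin l)) :
    ⟪S.drift x, b⟫ = ∑ k ∈ Finset.range (S.len x), ⟪S.tilt b k x, x k⟫ := by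
  rw [drift, if_neg hx, sum_inner]
  refine Finset.sum_congr rfl fun k _ => ?_
  rw [EuclideanSpace.inner_eq_star_dotProduct, EuclideanSpace.inner_eq_star_dotProduct,
    tilt, Matrix.toLpLin_apply, Matrix.toLpLin_apply, star_trivial, star_trivial,
    Matrix.dotProduct_mulVec, Matrix.vecMul_transpose, dotProduct_comm]

lemma curv_symm (x : SeqSpace d) (u v : EuclideanSpace ℝ (Fin l)) :
    ⟪S.curv x u, v⟫ = ⟪S.curv x v, u⟫ := by
  by_cases hx : S.τ x = ⊤
  · simp [S.curv_of_top hx]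
  · simp only [S.inner_curv hx, real_inner_comm]

lemma curv_nonneg (x : SeqSpace d) (v : EuclideanSpace ℝ (Fin l)) : 0 ≤ ⟪S.curv x v, v⟫ := by
  by_cases hx : S.τ x = ⊤
  · simp [S.curv_of_top hx]
  · rw [S.inner_curv_self hx]
    positivity

lemma quad_curv_drift {x : SeqSpace d} (hx : S.τ x ≠ ⊤) (b : EuclideanSpace ℝ (Fin l)) :
    quad (S.curv x) (S.drift x) b = ∑ k ∈ Finset.range (S.len x),
      ((1 / 2) * ‖S.tilt b k x‖ ^ 2 - ⟪S.tilt b k x, x k⟫) := by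
  rw [quad, S.inner_curv_self hx, S.inner_drift hx, Finset.sum_sub_distrib, Finset.mul_sum]
  norm_num

/-- The density is the exponential of a quadratic function of `b`, up to a factor which does not
depend on `b`; on `τ = ∞` the quadratic function is `0` and the factor is `ε`. -/
lemma L_eq (b : EuclideanSpace ℝ (Fin l)) (x : SeqSpace d) :
    S.L b x = (if S.τ x = ⊤ then S.ε else 1) * Real.exp (quad (S.curv x) (S.drift x) b) := by
  by_cases hx : S.τ x = ⊤
  · simp [L, hx, S.curv_of_top hx, S.drift_of_top hx, quad]
  · simp [L, hx, S.quad_curv_drift hx]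

lemma L_pos (b : EuclideanSpace ℝ (Fin l)) (x : SeqSpace d) : 0 < S.L b x := by
  rw [L_eq]
  have := S.ε_pos
  split_ifs <;> positivity

/-- Completing the square bounds `log L` from below, uniformly in `b`. -/
lemma neg_energy_le_quad (x : SeqSpace d) (b : EuclideanSpace ℝ (Fin l)) :
    -((1 / 2) * S.energy x) ≤ quad (S.curv x) (S.drift x) b := by
  by_cases hx : S.τ x = ⊤
  · simp [energy, S.len_of_top hx, S.curv_of_top hx, S.drift_of_top hx, quad]
  · rw [S.quad_curv_drift hx, energy, Finset.mul_sum, ← Finset.sum_neg_distrib]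
    refine Finset.sum_le_sum fun k _ => ?_
    have := norm_sub_sq_real (S.tilt b k x) (x k)
    nlinarith [sq_nonneg ‖S.tilt b k x - x k‖]

/-- Giving up half of the quadratic term, `log L` is bounded from below by a quadratic form in `b`,
up to a term independent of `b`. -/
lemma quarter_curv_sub_energy_le_quad (x : SeqSpace d) (b : EuclideanSpace ℝ (Fin l)) :
    (1 / 4) * ⟪S.curv x b, b⟫ - S.energy x ≤ quad (S.curv x) (S.drift x) b := by
  by_cases hx : S.τ x = ⊤
  · simp [energy, S.len_of_top hx, S.curv_of_top hx, S.drift_of_top hx, quad]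
  · rw [S.quad_curv_drift hx, energy, S.inner_curv_self hx, Finset.mul_sum,
      ← Finset.sum_sub_distrib]
    refine Finset.sum_le_sum fun k _ => ?_
    have h1 := real_inner_le_norm (S.tilt b k x) (x k)
    nlinarith [sq_nonneg (‖S.tilt b k x‖ - 2 * ‖x k‖)]

/-- In the event `A_b` the condition on the `λ_k(b)` says that `b` is not isotropic for `2 G`; the
condition `0 < τ` is implied. -/
lemma mem_A_iff (b : EuclideanSpace ℝ (Fin l)) (x : SeqSpace d) :
    x ∈ S.A b ↔ S.Z x ≠ 0 ∧ S.τ x ≠ ⊤ ∧ 0 < ⟪S.curv x b, b⟫ := by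
  simp only [A, mem_ofPred_eq]
  constructor
  · rintro ⟨h1, -, h3, k, hk, hb⟩
    refine ⟨h1, h3.ne, ?_⟩
    rw [S.inner_curv_self h3.ne]
    rw [← S.coe_len h3.ne, Nat.cast_lt] at hk
    exact Finset.sum_pos' (fun _ _ => by positivity) ⟨k, Finset.mem_range.2 hk, by positivity⟩
  · rintro ⟨h1, h2, h3⟩
    rw [S.inner_curv_self h2] at h3
    obtain ⟨k, hk, hb⟩ := Finset.exists_ne_zero_of_sum_ne_zero h3.ne'
    have hk' : (k : WithTop ℕ) < S.τ x := by
      rw [← S.coe_len h2, Nat.cast_lt]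
      exact Finset.mem_range.1 hk
    exact ⟨h1, lt_of_le_of_lt (zero_le (a := (k : WithTop ℕ))) hk', lt_top_iff_ne_top.2 h2, k, hk',
      by simpa using hb⟩

/-- Where the quadratic form of `curv` vanishes at `b`, all `λ_k(b)` with `k < τ` vanish, so the
linear term vanishes at `b` as well and the density is constant along that
direction. -/
lemma quad_add_smul {x : SeqSpace d} {b : EuclideanSpace ℝ (Fin l)} (hb : ⟪S.curv x b, b⟫ = 0)
    (a : EuclideanSpace ℝ (Fin l)) (t : ℝ) :
    quad (S.curv x) (S.drift x) (a + t • b) = quad (S.curv x) (S.drift x) a := by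
  by_cases hx : S.τ x = ⊤
  · simp [S.curv_of_top hx, S.drift_of_top hx, quad]
  · rw [S.inner_curv_self hx, Finset.sum_eq_zero_iff_of_nonneg fun _ _ => by positivity] at hb
    rw [S.quad_curv_drift hx, S.quad_curv_drift hx]
    refine Finset.sum_congr rfl fun k hk => ?_
    have h0 : S.tilt b k x = 0 := by simpa using hb k hk
    have h1 : S.tilt (a + t • b) k x = S.tilt a k x := by
      simp only [tilt, map_add, map_smul] at h0 ⊢
      rw [h0, smul_zero, add_zero]
    rw [h1]

/-! ### Measurability -/

lemma measurable_Λ (k : ℕ) (i : Fin d) (j : Fin l) : Measurable fun x => S.Λ k x i j :=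
  (S.adapted k i j).mono ((pathFiltration d).le k) le_rfl

lemma measurable_global_Z : Measurable S.Z :=
  S.measurable_Z.mono S.isStoppingTime.measurableSpace_le le_rfl

lemma measurableSet_τ_eq (n : ℕ) : MeasurableSet {x | S.τ x = n} :=
  (pathFiltration d).le n _ (S.isStoppingTime.measurableSet_eq n)

lemma setOf_τ_ne_top : {x | S.τ x ≠ ⊤} = ⋃ n : ℕ, {x | S.τ x = n} := by
  ext x
  simp only [mem_ofPred_eq, mem_iUnion, WithTop.ne_top_iff_exists, eq_comm]
  rfl

lemma measurableSet_τ_ne_top : MeasurableSet {x | S.τ x ≠ ⊤} := by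
  rw [setOf_τ_ne_top]
  exact MeasurableSet.iUnion S.measurableSet_τ_eq

lemma measurableSet_τ_eq_top : MeasurableSet {x | S.τ x = ⊤} := by
  simpa [compl_ofPred] using S.measurableSet_τ_ne_top.compl

@[fun_prop]
lemma measurable_len : Measurable S.len := by
  refine measurable_to_countable' fun n => ?_
  have : S.len ⁻¹' {n} = {x | S.τ x = n} ∪ {x | S.τ x = ⊤ ∧ n = 0} := by
    ext x
    by_cases hx : S.τ x = ⊤
    · simp [len, hx, eq_comm]
    · simp [← S.coe_len hx]
  rw [this]
  exact (S.measurableSet_τ_eq n).union (S.measurableSet_τ_eq_top.inter (.const _))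

/-- A process evaluated at the random time `len` is measurable. -/
lemma measurable_comp_len {β : Type*} [MeasurableSpace β] {f : ℕ → SeqSpace d → β}
    (hf : ∀ n, Measurable (f n)) : Measurable fun x => f (S.len x) x := by
  have h : Measurable fun p : SeqSpace d × ℕ => f p.2 p.1 :=
    measurable_from_prod_countable_left hf
  exact h.comp (measurable_id.prodMk S.measurable_len)

@[fun_prop]
lemma measurable_energy : Measurable S.energy :=
  S.measurable_comp_len (f := fun n x => ∑ k ∈ Finset.range n, ‖x k‖ ^ 2) fun n => by fun_prop

lemma measurable_G (i j : Fin l) : Measurable fun x => S.G x i j := by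
  have h : (fun x => S.G x i j) = fun x => if S.τ x = ⊤ then 0 else (1 / 2 : ℝ) *
      ∑ k ∈ Finset.range (S.len x), ∑ m, S.Λ k x m i * S.Λ k x m j := by
    funext x
    by_cases hx : S.τ x = ⊤
    · simp [G, hx]
    · simp [G, hx, Matrix.sum_apply, Matrix.mul_apply]
  rw [h]
  refine Measurable.ite S.measurableSet_τ_eq_top measurable_const
    ((S.measurable_comp_len (f := fun n x =>
      ∑ k ∈ Finset.range n, ∑ m, S.Λ k x m i * S.Λ k x m j) fun n => ?_).const_mul _)
  exact Finset.measurable_sum _ fun k _ => Finset.measurable_sum _ fun m _ =>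
    (S.measurable_Λ k m i).mul (S.measurable_Λ k m j)

lemma measurable_drift : Measurable S.drift := by
  refine Measurable.ite S.measurableSet_τ_eq_top measurable_const ?_
  refine S.measurable_comp_len (f := fun n x => ∑ k ∈ Finset.range n,
    (S.Λ k x)ᵀ.toEuclideanLin (x k)) fun n => Finset.measurable_sum _ fun k _ => ?_
  refine (WithLp.measurable_toLp 2 (Fin l → ℝ)).comp (measurable_pi_lambda _ fun i => ?_)
  change Measurable fun x => ∑ j, S.Λ k x j i * x k j
  refine Finset.measurable_sum _ fun j _ => (S.measurable_Λ k j i).mul ?_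
  fun_prop

lemma stronglyMeasurable_curv : StronglyMeasurable S.curv := by
  have h : StronglyMeasurable fun x => (2 : ℝ) • S.G x := by
    have : Measurable fun x => fun i j => S.G x i j :=
      measurable_pi_lambda _ fun i => measurable_pi_lambda _ fun j => S.measurable_G i j
    exact (Measurable.stronglyMeasurable this).const_smul (2 : ℝ)
  have hc : Continuous (Matrix.toEuclideanCLM (n := Fin l) (𝕜 := ℝ)) :=
    LinearMap.continuous_of_finiteDimensional
      (Matrix.toEuclideanCLM (n := Fin l) (𝕜 := ℝ)).toAlgEquiv.toLinearEquiv.toLinearMap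
  exact hc.comp_stronglyMeasurable h

lemma measurable_quad (b : EuclideanSpace ℝ (Fin l)) :
    Measurable fun x => quad (S.curv x) (S.drift x) b :=
  (continuous_quad.comp_stronglyMeasurable (S.stronglyMeasurable_curv.prodMk
    (S.measurable_drift.stronglyMeasurable.prodMk stronglyMeasurable_const))).measurable

lemma measurable_inner_curv (u v : EuclideanSpace ℝ (Fin l)) :
    Measurable fun x => ⟪S.curv x u, v⟫ := by
  have h : Continuous fun T : EuclideanSpace ℝ (Fin l) →L[ℝ] EuclideanSpace ℝ (Fin l) =>
    ⟪T u, v⟫ := by fun_prop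
  exact (h.comp_stronglyMeasurable S.stronglyMeasurable_curv).measurable

end LETGS.Setting

/-! ### The mean square as an integral with respect to the untilted law -/

namespace LETGS.Setting

variable {d l : ℕ} (S : Setting d l)

/-- The weight `1(τ < ∞) Z²`. -/
noncomputable def weight (x : SeqSpace d) : ℝ := if S.τ x = ⊤ then 0 else S.Z x ^ 2

lemma weight_nonneg (x : SeqSpace d) : 0 ≤ S.weight x := by
  rw [weight]; split_ifs <;> positivity

lemma measurable_weight : Measurable S.weight :=
  Measurable.ite S.measurableSet_τ_eq_top measurable_const (S.measurable_global_Z.pow_const 2)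

lemma weight_ne_zero {x : SeqSpace d} : S.weight x ≠ 0 ↔ S.Z x ≠ 0 ∧ S.τ x ≠ ⊤ := by
  rw [weight]; split_ifs with h <;> simp [h]

lemma measurable_L (b : EuclideanSpace ℝ (Fin l)) : Measurable (S.L b) := by
  have h : S.L b = fun x =>
      (if S.τ x = ⊤ then S.ε else 1) * Real.exp (quad (S.curv x) (S.drift x) b) :=
    funext fun x => S.L_eq b x
  rw [h]
  exact (Measurable.ite S.measurableSet_τ_eq_top measurable_const measurable_const).mul
    (S.measurable_quad b).exp

/-- Events of `𝓕_n` depend only on the first `n` coordinates. -/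
lemma mem_of_agree {n : ℕ} {B : Set (SeqSpace d)} (hB : MeasurableSet[pathFiltration d n] B)
    {x y : SeqSpace d} (h : ∀ i < n, x i = y i) (hy : y ∈ B) : x ∈ B := by
  obtain ⟨t, -, rfl⟩ := hB
  rw [mem_preimage] at hy ⊢
  rwa [show (fun i : Fin n => x i) = fun i : Fin n => y i from funext fun i => h i i.2]

/-- On `τ = n`, the values of `τ` and of the `𝓕_τ`-measurable variable `Z` depend only on the first
`n` coordinates. -/
lemma τ_Z_of_agree {n : ℕ} {x y : SeqSpace d} (h : ∀ i < n, x i = y i) (hy : S.τ y = n) :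
    S.τ x = n ∧ S.Z x = S.Z y := by
  have h1 : MeasurableSet[S.isStoppingTime.measurableSpace] (S.Z ⁻¹' {S.Z y} ∩ {x | S.τ x = n}) :=
    @MeasurableSet.inter _ S.isStoppingTime.measurableSpace _ _
      (S.measurable_Z (measurableSet_singleton _)) (S.isStoppingTime.measurableSet_eq' n)
  have h2 := mem_of_agree
    ((S.isStoppingTime.measurableSet_inter_eq_iff (S.Z ⁻¹' {S.Z y}) n).1 h1) h ⟨rfl, hy⟩
  exact ⟨h2.2, h2.1⟩

/-- Integrals with respect to `𝕍(b)` of functions of the first `n` coordinates are integrals with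
respect to `𝕌` with the density `γ_n(b)`. -/
lemma lintegral_V_of_agree (b : EuclideanSpace ℝ (Fin l)) {n : ℕ} {F : SeqSpace d → ℝ≥0∞}
    (hF : Measurable F) (h : ∀ x y, (∀ i < n, x i = y i) → F x = F y) :
    ∫⁻ x, F x ∂(S.V b) = ∫⁻ x, ENNReal.ofReal (S.γ b n x) * F x ∂(gaussianSeq d) := by
  rw [V, lintegral_map hF (S.measurable_tiltedPath b), ← S.lintegral_shiftStage b n hF]
  exact lintegral_congr fun x => h _ _ fun i hi => (S.shiftStage_of_lt b x hi).symm

lemma L_eq_of_τ_eq (b : EuclideanSpace ℝ (Fin l)) {n : ℕ} {x : SeqSpace d} (hx : S.τ x = n) :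
    S.L b x = Real.exp (∑ k ∈ Finset.range n,
      ((1 / 2) * ‖S.tilt b k x‖ ^ 2 - ⟪S.tilt b k x, x k⟫)) := by
  have h1 : S.τ x ≠ ⊤ := by rw [hx]; exact WithTop.coe_ne_top
  have h2 : S.len x = n := by rw [len, hx]; rfl
  rw [L, if_neg h1, h2]

lemma γ_mul_L (b : EuclideanSpace ℝ (Fin l)) {n : ℕ} {x : SeqSpace d} (hx : S.τ x = n) :
    S.γ b n x * S.L b x = 1 := by
  rw [S.L_eq_of_τ_eq b hx, γ, ← Real.exp_sum, ← Real.exp_add, ← Finset.sum_add_distrib,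
    Finset.sum_eq_zero fun k _ => by ring, Real.exp_zero]

/-- On `τ = n` one factor `L(b)` of the integrand cancels the density of `𝕍(b)`. -/
lemma setLIntegral_V_τ_eq (b : EuclideanSpace ℝ (Fin l)) (n : ℕ) :
    ∫⁻ x in {x | S.τ x = n}, ENNReal.ofReal ((S.Z x * S.L b x) ^ 2) ∂(S.V b) =
      ∫⁻ x in {x | S.τ x = n}, ENNReal.ofReal (S.Z x ^ 2 * S.L b x) ∂(gaussianSeq d) := by
  have hm := S.measurableSet_τ_eq n
  have hF : Measurable ({x | S.τ x = n}.indicator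
      fun x => ENNReal.ofReal ((S.Z x * S.L b x) ^ 2)) :=
    ((S.measurable_global_Z.mul (S.measurable_L b)).pow_const 2).ennreal_ofReal.indicator hm
  rw [← lintegral_indicator hm, ← lintegral_indicator hm, S.lintegral_V_of_agree b hF (n := n)]
  · refine lintegral_congr fun x => ?_
    by_cases hx : S.τ x = n
    · rw [indicator_of_mem (by exact hx), indicator_of_mem (by exact hx),
        ← ENNReal.ofReal_mul (S.γ_pos b n x).le]
      congr 1
      linear_combination (S.Z x ^ 2 * S.L b x) * S.γ_mul_L b hx
    · rw [indicator_of_notMem (by exact hx), indicator_of_notMem (by exact hx), mul_zero]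
  · intro x y hxy
    by_cases hy : S.τ y = n
    · obtain ⟨hx, hZ⟩ := S.τ_Z_of_agree hxy hy
      rw [indicator_of_mem (by exact hx), indicator_of_mem (by exact hy), hZ,
        S.L_eq_of_τ_eq b hx, S.L_eq_of_τ_eq b hy]
      congr 4
      refine Finset.sum_congr rfl fun k hk => ?_
      have hk' := Finset.mem_range.1 hk
      rw [S.tilt_congr b fun i hi => hxy i (hi.trans hk'), hxy k hk']
    · have hx : ¬ S.τ x = n := fun hx => hy (S.τ_Z_of_agree (fun i hi => (hxy i hi).symm) hx).1
      rw [indicator_of_notMem (by exact hx), indicator_of_notMem (by exact hy)]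

lemma setLIntegral_τ_ne_top (μ : Measure (SeqSpace d)) (F : SeqSpace d → ℝ≥0∞) :
    ∫⁻ x in {x | S.τ x ≠ ⊤}, F x ∂μ = ∑' n : ℕ, ∫⁻ x in {x | S.τ x = n}, F x ∂μ := by
  rw [setOf_τ_ne_top, lintegral_iUnion S.measurableSet_τ_eq]
  intro m n hmn
  refine disjoint_left.2 fun x hx hx' => hmn ?_
  have : (m : WithTop ℕ) = n := (show S.τ x = m from hx).symm.trans hx'
  exact_mod_cast this

/-- If `Z` vanishes almost surely on `τ = ∞`, the mean square is an integral with respect to `𝕌`,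
whose integrand is for every path the exponential of a convex quadratic function of `b`. -/
lemma msq_eq (hS : S.ZeroAtInfinity) (b : EuclideanSpace ℝ (Fin l)) :
    S.msq b = ∫⁻ x, ENNReal.ofReal
      (S.weight x * Real.exp (quad (S.curv x) (S.drift x) b)) ∂(gaussianSeq d) := by
  have h1 : ∫⁻ x in {x | S.τ x ≠ ⊤}ᶜ, ENNReal.ofReal ((S.Z x * S.L b x) ^ 2) ∂(S.V b) = 0 := by
    rw [← lintegral_indicator S.measurableSet_τ_ne_top.compl]
    have h0 : ∀ᵐ x ∂(S.V b), ¬ (S.Z x ≠ 0 ∧ S.τ x = ⊤) := by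
      rw [ae_iff]; simpa using hS.2 b
    rw [lintegral_congr_ae (g := fun _ => 0), lintegral_zero]
    filter_upwards [h0] with x hx
    by_cases hτ : S.τ x = ⊤
    · have hZ : S.Z x = 0 := by tauto
      simp [indicator, hZ]
    · simp [indicator, hτ]
  have h2 : ∫⁻ x in {x | S.τ x ≠ ⊤}ᶜ, ENNReal.ofReal
      (S.weight x * Real.exp (quad (S.curv x) (S.drift x) b)) ∂(gaussianSeq d) = 0 := by
    rw [setLIntegral_congr_fun (g := fun _ => 0) S.measurableSet_τ_ne_top.compl, lintegral_zero]
    intro x hx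
    have hτ : S.τ x = ⊤ := not_not.1 hx
    simp [weight, hτ]
  rw [msq, ← lintegral_add_compl _ S.measurableSet_τ_ne_top, h1,
    ← lintegral_add_compl (μ := gaussianSeq d) _ S.measurableSet_τ_ne_top, h2, add_zero, add_zero,
    setLIntegral_τ_ne_top, setLIntegral_τ_ne_top]
  refine tsum_congr fun n => ?_
  rw [S.setLIntegral_V_τ_eq b n]
  refine setLIntegral_congr_fun (S.measurableSet_τ_eq n) fun x hx => ?_
  have hτ : S.τ x ≠ ⊤ := by rw [show S.τ x = n from hx]; exact WithTop.coe_ne_top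
  simp [S.L_eq, weight, hτ]

end LETGS.Setting

/-! ### Convexity, coercivity and minimum points of the mean square -/

/-- Fatou's lemma: the integral of nonnegative functions which are continuous in a parameter is
lower semicontinuous in that parameter. -/
lemma lowerSemicontinuous_lintegral_of_continuous {E X : Type*} [TopologicalSpace E]
    [SequentialSpace E] [MeasurableSpace X] {μ : Measure X} {F : E → X → ℝ≥0∞}
    (hm : ∀ b, Measurable (F b)) (hc : ∀ x, Continuous fun b => F b x) :
    LowerSemicontinuous fun b => ∫⁻ x, F b x ∂μ := by
  refine lowerSemicontinuous_iff_isClosed_preimage.2 fun y => IsSeqClosed.isClosed ?_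
  intro u b hu hb
  have h1 : ∀ x, F b x = liminf (fun n => F (u n) x) atTop := fun x =>
    (((hc x).tendsto b).comp hb).liminf_eq.symm
  change ∫⁻ x, F b x ∂μ ≤ y
  simp_rw [h1]
  refine (lintegral_liminf_le fun n => hm (u n)).trans ?_
  exact liminf_le_of_le (by isBoundedDefault) fun c hc => by
    obtain ⟨n, hn⟩ := hc.exists
    exact hn.trans (hu n)

lemma ofReal_combo_lt_top (s t : ℝ) {p q : ℝ≥0∞} (hp : p < ⊤) (hq : q < ⊤) :
    ENNReal.ofReal s * p + ENNReal.ofReal t * q < ⊤ := ENNReal.add_lt_top.2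
  ⟨ENNReal.mul_lt_top ENNReal.ofReal_lt_top hp, ENNReal.mul_lt_top ENNReal.ofReal_lt_top hq⟩

lemma toReal_ofReal_combo {s t : ℝ} (hs : 0 ≤ s) (ht : 0 ≤ t) {p q : ℝ≥0∞} (hp : p < ⊤)
    (hq : q < ⊤) :
    (ENNReal.ofReal s * p + ENNReal.ofReal t * q).toReal = s * p.toReal + t * q.toReal := by
  rw [ENNReal.toReal_add (ENNReal.mul_lt_top ENNReal.ofReal_lt_top hp).ne
    (ENNReal.mul_lt_top ENNReal.ofReal_lt_top hq).ne, ENNReal.toReal_mul, ENNReal.toReal_mul,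
    ENNReal.toReal_ofReal hs, ENNReal.toReal_ofReal ht]

namespace LETGS.Setting

variable {d l : ℕ} (S : Setting d l)

/-- The integrand of the mean square with respect to `𝕌`. -/
noncomputable def msqIntegrand (b : EuclideanSpace ℝ (Fin l)) (x : SeqSpace d) : ℝ≥0∞ :=
  ENNReal.ofReal (S.weight x * Real.exp (quad (S.curv x) (S.drift x) b))

lemma measurable_msqIntegrand (b : EuclideanSpace ℝ (Fin l)) : Measurable (S.msqIntegrand b) :=
  (S.measurable_weight.mul (S.measurable_quad b).exp).ennreal_ofReal

lemma ofReal_mul_msqIntegrand_add {s t : ℝ} (hs : 0 ≤ s) (ht : 0 ≤ t)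
    (u v : EuclideanSpace ℝ (Fin l)) (x : SeqSpace d) :
    ENNReal.ofReal s * S.msqIntegrand u x + ENNReal.ofReal t * S.msqIntegrand v x =
      ENNReal.ofReal (S.weight x * (s * Real.exp (quad (S.curv x) (S.drift x) u) +
        t * Real.exp (quad (S.curv x) (S.drift x) v))) := by
  have hw := S.weight_nonneg x
  rw [msqIntegrand, msqIntegrand, ← ENNReal.ofReal_mul hs, ← ENNReal.ofReal_mul ht,
    ← ENNReal.ofReal_add (by positivity) (by positivity)]
  congr 1
  ring

lemma msqIntegrand_combo_le {s t : ℝ} (hs : 0 ≤ s) (ht : 0 ≤ t) (hst : s + t = 1)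
    (u v : EuclideanSpace ℝ (Fin l)) (x : SeqSpace d) :
    S.msqIntegrand (s • u + t • v) x ≤
      ENNReal.ofReal s * S.msqIntegrand u x + ENNReal.ofReal t * S.msqIntegrand v x := by
  rw [S.ofReal_mul_msqIntegrand_add hs ht]
  exact ENNReal.ofReal_le_ofReal (mul_le_mul_of_nonneg_left
    (exp_quad_combo_le (S.curv_symm x) (S.curv_nonneg x) _ u v hs ht hst) (S.weight_nonneg x))

lemma msqIntegrand_combo_lt {s t : ℝ} (hs : 0 < s) (ht : 0 < t) (hst : s + t = 1)
    {u v : EuclideanSpace ℝ (Fin l)} {x : SeqSpace d} (hx : x ∈ S.A (u - v)) :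
    S.msqIntegrand (s • u + t • v) x <
      ENNReal.ofReal s * S.msqIntegrand u x + ENNReal.ofReal t * S.msqIntegrand v x := by
  rw [S.ofReal_mul_msqIntegrand_add hs.le ht.le]
  obtain ⟨h1, h2, h3⟩ := (S.mem_A_iff _ x).1 hx
  have hw : 0 < S.weight x :=
    lt_of_le_of_ne (S.weight_nonneg x) (S.weight_ne_zero.2 ⟨h1, h2⟩).symm
  exact (ENNReal.ofReal_lt_ofReal_iff (by positivity)).2 (mul_lt_mul_of_pos_left
    (exp_quad_combo_lt (S.curv_symm x) _ u v h3 hs ht hst) hw)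

lemma lintegral_combo (s t : ℝ) (u v : EuclideanSpace ℝ (Fin l)) :
    ∫⁻ x, (ENNReal.ofReal s * S.msqIntegrand u x + ENNReal.ofReal t * S.msqIntegrand v x)
      ∂(gaussianSeq d) = ENNReal.ofReal s * ∫⁻ x, S.msqIntegrand u x ∂(gaussianSeq d) +
        ENNReal.ofReal t * ∫⁻ x, S.msqIntegrand v x ∂(gaussianSeq d) := by
  have hu := S.measurable_msqIntegrand u
  have hv := S.measurable_msqIntegrand v
  rw [lintegral_add_left (by fun_prop), lintegral_const_mul _ hu, lintegral_const_mul _ hv]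

lemma msq_combo_le (hS : S.ZeroAtInfinity) {s t : ℝ} (hs : 0 ≤ s) (ht : 0 ≤ t) (hst : s + t = 1)
    (u v : EuclideanSpace ℝ (Fin l)) :
    S.msq (s • u + t • v) ≤ ENNReal.ofReal s * S.msq u + ENNReal.ofReal t * S.msq v := by
  simp only [S.msq_eq hS]
  exact (lintegral_mono fun x => S.msqIntegrand_combo_le hs ht hst u v x).trans_eq
    (S.lintegral_combo s t u v)

/-- The inequality is strict because the integrand is strictly convex on the segment from `u` to `v`
for the paths in `A (u - v)`, a set of positive probability. -/
lemma msq_combo_lt (hS : S.ZeroAtInfinity) (hC : S.LinIndepCond) {s t : ℝ} (hs : 0 < s)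
    (ht : 0 < t) (hst : s + t = 1) {u v : EuclideanSpace ℝ (Fin l)} (huv : u ≠ v)
    (hu : S.msq u < ⊤) (hv : S.msq v < ⊤) :
    S.msq (s • u + t • v) < ENNReal.ofReal s * S.msq u + ENNReal.ofReal t * S.msq v := by
  have hle := S.msq_combo_le hS hs.le ht.le hst u v
  refine lt_of_le_of_ne hle fun heq => ?_
  have hfin : S.msq (s • u + t • v) < ⊤ := hle.trans_lt (ofReal_combo_lt_top s t hu hv)
  simp only [S.msq_eq hS] at heq hfin
  have hmu := S.measurable_msqIntegrand u
  have hmv := S.measurable_msqIntegrand v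
  have hae := ae_eq_of_ae_le_of_lintegral_le
    (.of_forall fun x => S.msqIntegrand_combo_le hs.le ht.le hst u v x) hfin.ne
    (by fun_prop) ((S.lintegral_combo s t u v).trans heq.symm).le
  refine (hC (u - v) (sub_ne_zero.2 huv)).ne' (measure_mono_null (fun x hx => ?_) (ae_iff.1 hae))
  exact (S.msqIntegrand_combo_lt hs ht hst hx).ne

lemma convex_finiteSet (hS : S.ZeroAtInfinity) : Convex ℝ (finiteSet S.msq) :=
  fun u hu v hv s t hs ht hst =>
    (S.msq_combo_le hS hs ht hst u v).trans_lt (ofReal_combo_lt_top s t hu hv)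

lemma convexOn_toReal_msq (hS : S.ZeroAtInfinity) :
    ConvexOn ℝ (finiteSet S.msq) fun b => (S.msq b).toReal := by
  refine ⟨S.convex_finiteSet hS, fun u hu v hv s t hs ht hst => ?_⟩
  simp only [smul_eq_mul]
  rw [← toReal_ofReal_combo hs ht hu hv]
  exact ENNReal.toReal_mono (ofReal_combo_lt_top s t hu hv).ne (S.msq_combo_le hS hs ht hst u v)

lemma strictConvexOn_toReal_msq (hS : S.ZeroAtInfinity) (hC : S.LinIndepCond) :
    StrictConvexOn ℝ (finiteSet S.msq) fun b => (S.msq b).toReal := by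
  refine ⟨S.convex_finiteSet hS, fun u hu v hv huv s t hs ht hst => ?_⟩
  simp only [smul_eq_mul]
  rw [← toReal_ofReal_combo hs.le ht.le hu hv]
  exact ENNReal.toReal_strict_mono (ofReal_combo_lt_top s t hu hv).ne
    (S.msq_combo_lt hS hC hs ht hst huv hu hv)

lemma lowerSemicontinuous_msq (hS : S.ZeroAtInfinity) : LowerSemicontinuous S.msq := by
  rw [show S.msq = _ from funext (S.msq_eq hS)]
  refine lowerSemicontinuous_lintegral_of_continuous S.measurable_msqIntegrand fun x => ?_
  have : Continuous fun b => quad (S.curv x) (S.drift x) b :=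
    continuous_quad.comp (by fun_prop : Continuous fun b => (S.curv x, S.drift x, b))
  exact ENNReal.continuous_ofReal.comp (by fun_prop)

/-- A quadratic lower bound of the mean square. Its values lie in `[0, ∞]`: without the
integrability condition the coefficients of this form need not be finite. -/
noncomputable def quadLower (b : EuclideanSpace ℝ (Fin l)) : ℝ≥0∞ :=
  ∫⁻ x, ENNReal.ofReal (S.weight x * (Real.exp (-S.energy x) * ((1 / 4) * ⟪S.curv x b, b⟫)))
    ∂(gaussianSeq d)

lemma measurable_quadLower_integrand (b : EuclideanSpace ℝ (Fin l)) : Measurable fun x =>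
    ENNReal.ofReal (S.weight x * (Real.exp (-S.energy x) * ((1 / 4) * ⟪S.curv x b, b⟫))) :=
  (S.measurable_weight.mul (S.measurable_energy.neg.exp.mul
    ((S.measurable_inner_curv b b).const_mul _))).ennreal_ofReal

lemma quadLower_le_msq (hS : S.ZeroAtInfinity) (b : EuclideanSpace ℝ (Fin l)) :
    S.quadLower b ≤ S.msq b := by
  rw [S.msq_eq hS]
  refine lintegral_mono fun x => ENNReal.ofReal_le_ofReal
    (mul_le_mul_of_nonneg_left ?_ (S.weight_nonneg x))
  calc _ ≤ Real.exp (-S.energy x) * Real.exp ((1 / 4) * ⟪S.curv x b, b⟫) := by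
        gcongr
        linarith [Real.add_one_le_exp ((1 / 4) * ⟪S.curv x b, b⟫)]
    _ ≤ _ := by
        rw [← Real.exp_add]
        exact Real.exp_le_exp.2 (by linarith [S.quarter_curv_sub_energy_le_quad x b])

lemma quadLower_smul (c : ℝ) (b : EuclideanSpace ℝ (Fin l)) :
    S.quadLower (c • b) = ENNReal.ofReal (c ^ 2) * S.quadLower b := by
  rw [quadLower, quadLower, ← lintegral_const_mul _ (S.measurable_quadLower_integrand b)]
  refine lintegral_congr fun x => ?_
  rw [← ENNReal.ofReal_mul (sq_nonneg c), map_smul, inner_smul_left, inner_smul_right]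
  congr 1
  simp only [conj_trivial]
  ring

lemma quadLower_pos (hC : S.LinIndepCond) {b : EuclideanSpace ℝ (Fin l)} (hb : b ≠ 0) :
    0 < S.quadLower b := by
  refine pos_iff_ne_zero.2 fun h0 => (hC b hb).ne' ?_
  rw [quadLower, lintegral_eq_zero_iff (S.measurable_quadLower_integrand b)] at h0
  refine measure_mono_null (fun x hx => ?_) (ae_iff.1 h0)
  obtain ⟨h1, h2, h3⟩ := (S.mem_A_iff b x).1 hx
  have hw : 0 < S.weight x :=
    lt_of_le_of_ne (S.weight_nonneg x) (S.weight_ne_zero.2 ⟨h1, h2⟩).symm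
  exact (ENNReal.ofReal_pos.2 (by positivity)).ne'

lemma lowerSemicontinuous_quadLower : LowerSemicontinuous S.quadLower := by
  refine lowerSemicontinuous_lintegral_of_continuous S.measurable_quadLower_integrand fun x => ?_
  exact ENNReal.continuous_ofReal.comp (by fun_prop)

/-- The quadratic lower bound has a positive, possibly infinite, minimum on the unit sphere, since
it is lower semicontinuous; by homogeneity the mean square grows at least quadratically. -/
lemma tendsto_msq [NeZero l] (hS : S.ZeroAtInfinity) (hC : S.LinIndepCond) :
    Tendsto S.msq (Bornology.cobounded _) (𝓝 ⊤) := by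
  have hne : (Metric.sphere (0 : EuclideanSpace ℝ (Fin l)) 1).Nonempty :=
    NormedSpace.sphere_nonempty.2 zero_le_one
  obtain ⟨e, he, hmin⟩ := (S.lowerSemicontinuous_quadLower.lowerSemicontinuousOn _).exists_isMinOn
    hne (isCompact_sphere _ _)
  have he0 : e ≠ 0 := fun h => by simp [h] at he
  have hlow : ∀ b, ENNReal.ofReal (‖b‖ ^ 2) * S.quadLower e ≤ S.msq b := by
    intro b
    refine le_trans ?_ (S.quadLower_le_msq hS b)
    by_cases hb : b = 0
    · simp [hb]
    · have hb' : ‖b‖ ≠ 0 := norm_ne_zero_iff.2 hb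
      have h1 : S.quadLower b = ENNReal.ofReal (‖b‖ ^ 2) * S.quadLower (‖b‖⁻¹ • b) := by
        rw [← S.quadLower_smul, smul_smul, mul_inv_cancel₀ hb', one_smul]
      rw [h1]
      gcongr
      exact hmin (by simp [norm_smul, hb'])
  refine tendsto_nhds_top_mono' ?_ hlow
  have h1 : Tendsto (fun b : EuclideanSpace ℝ (Fin l) => ENNReal.ofReal (‖b‖ ^ 2))
      (Bornology.cobounded _) (𝓝 ⊤) :=
    ENNReal.tendsto_ofReal_atTop.comp
      ((tendsto_pow_atTop two_ne_zero).comp tendsto_norm_cobounded_atTop)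
  have h2 := ENNReal.Tendsto.mul_const (b := S.quadLower e) h1 (Or.inl ENNReal.top_ne_zero)
  rwa [ENNReal.top_mul (S.quadLower_pos hC he0).ne'] at h2

lemma strictCond_msq [NeZero l] (hS : S.ZeroAtInfinity) (hC : S.LinIndepCond)
    (hfin : ∃ b, S.msq b < ⊤) : StrictCond S.msq :=
  ⟨S.lowerSemicontinuous_msq hS, S.tendsto_msq hS hC, hfin, S.convex_finiteSet hS,
    S.strictConvexOn_toReal_msq hS hC⟩

lemma exists_unique_min_msq [NeZero l] (hS : S.ZeroAtInfinity) (hC : S.LinIndepCond)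
    (hfin : ∃ b, S.msq b < ⊤) :
    ∃ b₀, S.msq b₀ < ⊤ ∧ ∀ b, b ≠ b₀ → S.msq b₀ < S.msq b := by
  obtain ⟨c, hc⟩ := hfin
  obtain ⟨R, -, hR⟩ := hasBasis_cobounded_norm.eventually_iff.1
    ((S.tendsto_msq hS hC).eventually (lt_mem_nhds hc))
  have hcR : c ∈ Metric.closedBall (0 : EuclideanSpace ℝ (Fin l)) R := by
    by_contra h
    exact lt_irrefl _ (hR (x := c) (by simpa using (not_le.1 (by simpa using h)).le))
  obtain ⟨b₀, -, hmin⟩ := ((S.lowerSemicontinuous_msq hS).lowerSemicontinuousOn _).exists_isMinOn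
    ⟨c, hcR⟩ (isCompact_closedBall _ _)
  have hle : ∀ b, S.msq b₀ ≤ S.msq b := by
    intro b
    by_cases hb : b ∈ Metric.closedBall (0 : EuclideanSpace ℝ (Fin l)) R
    · exact hmin hb
    · exact (hmin hcR).trans (hR (x := b) (by simpa using (not_le.1 (by simpa using hb)).le)).le
  have hb₀ : S.msq b₀ < ⊤ := (hle c).trans_lt hc
  refine ⟨b₀, hb₀, fun b hb => lt_of_le_of_ne (hle b) fun heq => ?_⟩
  -- A second minimum point would make the mean square smaller at the midpoint.
  have h := S.msq_combo_lt hS hC (one_half_pos (α := ℝ)) one_half_pos (add_halves 1) hb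
    (heq ▸ hb₀) hb₀
  rw [← heq, ← add_mul, ← ENNReal.ofReal_add (by norm_num) (by norm_num), add_halves,
    ENNReal.ofReal_one, one_mul] at h
  exact absurd h (hle _).not_gt

lemma exists_msq_add_smul (hS : S.ZeroAtInfinity) (hC : ¬ S.LinIndepCond) :
    ∃ b : EuclideanSpace ℝ (Fin l), b ≠ 0 ∧ ∀ a (t : ℝ), S.msq (a + t • b) = S.msq a := by
  simp only [LinIndepCond, not_forall, not_lt, nonpos_iff_eq_zero] at hC
  obtain ⟨b, hb, h0⟩ := hC
  refine ⟨b, hb, fun a t => ?_⟩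
  rw [S.msq_eq hS, S.msq_eq hS]
  have h1 : ∀ᵐ x ∂(gaussianSeq d), x ∉ S.A b := measure_eq_zero_iff_ae_notMem.1 h0
  refine lintegral_congr_ae (h1.mono fun x hx => ?_)
  by_cases hw : S.weight x = 0
  · simp [hw]
  · obtain ⟨hZ, hτ⟩ := S.weight_ne_zero.1 hw
    rw [S.mem_A_iff] at hx
    have h2 : ⟪S.curv x b, b⟫ = 0 :=
      le_antisymm (not_lt.1 fun h => hx ⟨hZ, hτ, h⟩) (S.curv_nonneg x b)
    simp only [S.quad_add_smul h2]

end LETGS.Setting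

/-! ### The lower bound of the Hessian -/

namespace LETGS.Setting

set_option maxSynthPendingDepth 3

variable {d l : ℕ} (S : Setting d l)

lemma two_smul_G_apply (x : SeqSpace d) (i j : Fin l) :
    ((2 : ℝ) • S.G x) i j =
      ⟪S.curv x (EuclideanSpace.single j 1), EuclideanSpace.single i 1⟫ := by
  rw [inner_curv_eq_dotProduct]
  simp

/-- The integral of `w exp (-energy / 2) 2 G` along a family `p` of paths weighted by `w`. For the
law `𝕌` and the weight `1(τ < ∞) Z²` this is the matrix `M`; for finitely many paths it is the
analogous bound for the mean square estimators. -/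
noncomputable def lowerMatrix {X : Type*} [MeasurableSpace X] (μ : Measure X) (w : X → ℝ)
    (p : X → SeqSpace d) : Matrix (Fin l) (Fin l) ℝ :=
  Matrix.of fun i j => ∫ x, ((w x * Real.exp (-((1 / 2) * S.energy (p x)))) •
    ((2 : ℝ) • S.G (p x))) i j ∂μ

section LowerMatrix

variable {X : Type*} [MeasurableSpace X] {μ : Measure X} {w : X → ℝ} {p : X → SeqSpace d} {C : ℝ}

lemma integrable_lowerMatrix_entry
    (D : ExpQuadDominated μ w (fun x => S.curv (p x)) (fun x => S.drift (p x)) C)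
    (hp : Measurable p) (i j : Fin l) :
    Integrable (fun x => ((w x * Real.exp (-((1 / 2) * S.energy (p x)))) •
      ((2 : ℝ) • S.G (p x))) i j) μ := by
  have hw : Integrable w μ := by simpa using D.integrable 0
  have hm : AEStronglyMeasurable (fun x => (w x * Real.exp (-((1 / 2) * S.energy (p x)))) *
      (2 * S.G (p x) i j)) μ := by
    refine (D.aesm_w.mul ?_).mul ?_
    · exact (((S.measurable_energy.const_mul (1 / 2)).neg.exp).comp hp).aestronglyMeasurable
    · exact (((S.measurable_G i j).const_mul 2).comp hp).aestronglyMeasurable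
  refine (hw.norm.mul_const C).mono' hm ?_
  filter_upwards [D.bound] with x hx
  rw [Matrix.smul_apply, smul_eq_mul, norm_mul, norm_mul, two_smul_G_apply]
  by_cases hw0 : w x = 0
  · simp [hw0]
  · have h1 : ‖Real.exp (-((1 / 2) * S.energy (p x)))‖ ≤ 1 := by
      rw [Real.norm_eq_abs, Real.abs_exp, Real.exp_le_one_iff]
      linarith [S.energy_nonneg (p x)]
    have h2 : ‖⟪S.curv (p x) (EuclideanSpace.single j 1),
        (EuclideanSpace.single i 1 : EuclideanSpace ℝ (Fin l))⟫‖ ≤ C := by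
      refine (norm_inner_le_norm _ _).trans ?_
      have := (S.curv (p x)).le_of_opNorm_le (hx hw0) (EuclideanSpace.single j 1)
      simpa using this
    -- The exponential is at most `1` and the entries of `2 G` are at most `C`.
    calc _ ≤ ‖w x‖ * 1 * C := by gcongr
      _ = _ := by ring

lemma isHermitian_lowerMatrix : (S.lowerMatrix μ w p).IsHermitian := by
  ext i j
  simp only [lowerMatrix, Matrix.conjTranspose_apply, Matrix.of_apply, star_trivial]
  refine integral_congr_ae (.of_forall fun x => ?_)
  simp only [Matrix.smul_apply (_ * _), two_smul_G_apply]
  rw [S.curv_symm]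

lemma dotProduct_lowerMatrix_mulVec
    (D : ExpQuadDominated μ w (fun x => S.curv (p x)) (fun x => S.drift (p x)) C)
    (hp : Measurable p) (v : EuclideanSpace ℝ (Fin l)) :
    v.ofLp ⬝ᵥ (S.lowerMatrix μ w p *ᵥ v.ofLp) =
      ∫ x, w x * (Real.exp (-((1 / 2) * S.energy (p x))) * ⟪S.curv (p x) v, v⟫) ∂μ := by
  rw [lowerMatrix, dotProduct_integral_mulVec (S.integrable_lowerMatrix_entry D hp)]
  refine integral_congr_ae (.of_forall fun x => ?_)
  simp only [Matrix.smul_mulVec (_ * _), dotProduct_smul, inner_curv_eq_dotProduct, smul_eq_mul]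
  ring

lemma posSemidef_hessian_sub_lowerMatrix
    (D : ExpQuadDominated μ w (fun x => S.curv (p x)) (fun x => S.drift (p x)) C)
    (hp : Measurable p) (hw : ∀ x, 0 ≤ w x) (b : EuclideanSpace ℝ (Fin l)) :
    (hessian (fun b => ∫ x, w x * Real.exp (quad (S.curv (p x)) (S.drift (p x)) b) ∂μ) b -
      S.lowerMatrix μ w p).PosSemidef :=
  D.posSemidef_hessian_sub hw (fun x => S.curv_nonneg (p x))
    (fun x => S.neg_energy_le_quad (p x)) S.isHermitian_lowerMatrix
    (fun v => (S.dotProduct_lowerMatrix_mulVec D hp v).le) b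

lemma posDef_lowerMatrix
    (D : ExpQuadDominated μ w (fun x => S.curv (p x)) (fun x => S.drift (p x)) C)
    (hp : Measurable p) (hw : ∀ x, 0 ≤ w x)
    (hpos : ∀ v, v ≠ 0 → μ {x | w x ≠ 0 ∧ 0 < ⟪S.curv (p x) v, v⟫} ≠ 0) :
    (S.lowerMatrix μ w p).PosDef := by
  refine .of_dotProduct_mulVec_pos S.isHermitian_lowerMatrix fun v hv => ?_
  have hv' : WithLp.toLp 2 v ≠ 0 := fun h => hv (by simpa using congrArg WithLp.ofLp h)
  have h := S.dotProduct_lowerMatrix_mulVec D hp (WithLp.toLp 2 v)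
  have hnn : ∀ x, 0 ≤ w x * (Real.exp (-((1 / 2) * S.energy (p x))) *
      ⟪S.curv (p x) (WithLp.toLp 2 v), WithLp.toLp 2 v⟫) := fun x =>
    mul_nonneg (hw x) (mul_nonneg (Real.exp_pos _).le (S.curv_nonneg _ _))
  have hint : Integrable (fun x => w x * (Real.exp (-((1 / 2) * S.energy (p x))) *
      ⟪S.curv (p x) (WithLp.toLp 2 v), WithLp.toLp 2 v⟫)) μ := by
    have : Integrable (fun x => ∑ i, ∑ j, v i * (((w x * Real.exp (-((1 / 2) * S.energy (p x)))) •
        ((2 : ℝ) • S.G (p x))) i j * v j)) μ :=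
      integrable_finsetSum _ fun i _ => integrable_finsetSum _ fun j _ =>
        ((S.integrable_lowerMatrix_entry D hp i j).mul_const _).const_mul _
    refine this.congr (.of_forall fun x => ?_)
    simp only [inner_curv_eq_dotProduct, dotProduct, Matrix.mulVec, Finset.mul_sum,
      Matrix.smul_apply, smul_eq_mul]
    exact Finset.sum_congr rfl fun i _ => Finset.sum_congr rfl fun j _ => by ring
  rw [star_trivial]
  refine lt_of_lt_of_eq ?_ h.symm
  rw [integral_pos_iff_support_of_nonneg hnn hint, pos_iff_ne_zero]
  refine fun h0 => hpos _ hv' (measure_mono_null (fun x hx => ?_) h0)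
  exact mul_ne_zero hx.1 (mul_ne_zero (Real.exp_ne_zero _) hx.2.ne')

end LowerMatrix

end LETGS.Setting

/-! ### The mean square under the integrability condition -/

lemma norm_le_of_forall_inner_le {E : Type*} [NormedAddCommGroup E] [InnerProductSpace ℝ E] {a : E}
    {c : ℝ} (hc : 0 ≤ c) (h : ∀ v, ⟪a, v⟫ ≤ c * ‖v‖) : ‖a‖ ≤ c := by
  have h1 := h a
  rw [real_inner_self_eq_norm_sq, sq] at h1
  rcases (norm_nonneg a).eq_or_lt with h0 | h0
  · rwa [← h0]
  · exact le_of_mul_le_mul_right h1 h0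

lemma exists_ae_le_ofReal_of_essSup_lt_top {X : Type*} [MeasurableSpace X] {μ : Measure X}
    {F : X → ℝ≥0∞} (hF : essSup F μ < ⊤) :
    ∃ K : ℝ, 0 ≤ K ∧ ∀ᵐ x ∂μ, F x ≤ ENNReal.ofReal K :=
  ⟨(essSup F μ).toReal, ENNReal.toReal_nonneg, by
    rw [ENNReal.ofReal_toReal hF.ne]
    exact ENNReal.ae_le_essSup F⟩

/-- The exponential of a sum of norms is bounded by a finite sum of exponentials of linear
functions, one for each choice of signs of the coordinates. -/
lemma exp_sum_norm_le {d s : ℕ} {ρ : ℝ} (hρ : 0 ≤ ρ) (y : Fin s → EuclideanSpace ℝ (Fin d)) :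
    Real.exp (ρ * ∑ i, ‖y i‖) ≤ ∑ σ : Fin s × Fin d → Bool, Real.exp (∑ i,
      ⟪(WithLp.toLp 2 fun j => if σ (i, j) then ρ else -ρ : EuclideanSpace ℝ (Fin d)), y i⟫) := by
  have h1 : ∀ i, ‖y i‖ ≤ ∑ j, |y i j| := fun i => by
    have := norm_sum_le Finset.univ fun j => (EuclideanSpace.single j (y i j) :
      EuclideanSpace ℝ (Fin d))
    have hy : ∑ j, (EuclideanSpace.single j (y i j) : EuclideanSpace ℝ (Fin d)) = y i := by
      ext k
      simp [Pi.single_apply]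
    rw [hy] at this
    simpa using this
  have h2 : ∀ a : ℝ, Real.exp (ρ * |a|) ≤
      ∑ e : Bool, Real.exp ((if e then ρ else -ρ) * a) := fun a => by
    have e1 := Real.exp_pos (ρ * a)
    have e2 := Real.exp_pos (-(ρ * a))
    rcases abs_cases a with ⟨h, -⟩ | ⟨h, -⟩ <;> simp [h] <;> linarith
  calc Real.exp (ρ * ∑ i, ‖y i‖)
      ≤ Real.exp (ρ * ∑ q : Fin s × Fin d, |y q.1 q.2|) := by
        rw [Fintype.sum_prod_type]
        gcongr with i
        exact h1 i
    _ = ∏ q : Fin s × Fin d, Real.exp (ρ * |y q.1 q.2|) := by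
        rw [Finset.mul_sum, Real.exp_sum]
    _ ≤ ∏ q : Fin s × Fin d, ∑ e : Bool, Real.exp ((if e then ρ else -ρ) * y q.1 q.2) :=
        Finset.prod_le_prod (fun _ _ => (Real.exp_pos _).le) fun q _ => h2 _
    _ = _ := by
        rw [Finset.prod_univ_sum, Fintype.piFinset_univ]
        refine Finset.sum_congr rfl fun σ _ => ?_
        rw [← Real.exp_sum, Fintype.sum_prod_type]
        congr 1
        refine Finset.sum_congr rfl fun i _ => ?_
        simp [PiLp.inner_apply, mul_comm]

namespace LETGS.Setting

variable {d l : ℕ} (S : Setting d l)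

lemma norm_curv_le {x : SeqSpace d} (hx : S.τ x ≠ ⊤) {K : ℝ} {s : ℕ} (hs : S.len x ≤ s)
    (hK : 0 ≤ K) (h : ∀ k < S.len x, ∀ v, ‖S.tilt v k x‖ ≤ K * ‖v‖) :
    ‖S.curv x‖ ≤ s * K ^ 2 := by
  refine ContinuousLinearMap.opNorm_le_bound _ (by positivity) fun u => ?_
  refine norm_le_of_forall_inner_le (by positivity) fun v => ?_
  rw [S.inner_curv hx]
  have hs' : (S.len x : ℝ) ≤ s := by exact_mod_cast hs
  calc _ ≤ ∑ k ∈ Finset.range (S.len x), (K * ‖u‖) * (K * ‖v‖) := by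
        refine Finset.sum_le_sum fun k hk => (real_inner_le_norm _ _).trans ?_
        have hk' := Finset.mem_range.1 hk
        exact mul_le_mul (h k hk' u) (h k hk' v) (norm_nonneg _) (by positivity)
    _ = S.len x * (K * ‖u‖ * (K * ‖v‖)) := by simp
    _ ≤ s * (K * ‖u‖ * (K * ‖v‖)) := by gcongr
    _ = _ := by ring

lemma norm_drift_le {x : SeqSpace d} (hx : S.τ x ≠ ⊤) {K : ℝ} {s : ℕ} (hs : S.len x ≤ s)
    (hK : 0 ≤ K) (h : ∀ k < S.len x, ∀ v, ‖S.tilt v k x‖ ≤ K * ‖v‖) :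
    ‖S.drift x‖ ≤ K * ∑ i : Fin s, ‖x i‖ := by
  refine norm_le_of_forall_inner_le (by positivity) fun v => ?_
  rw [S.inner_drift hx, Fin.sum_univ_eq_sum_range fun k => ‖x k‖]
  calc _ ≤ ∑ k ∈ Finset.range (S.len x), (K * ‖v‖) * ‖x k‖ := by
        refine Finset.sum_le_sum fun k hk => (real_inner_le_norm _ _).trans ?_
        exact mul_le_mul_of_nonneg_right (h k (Finset.mem_range.1 hk) v) (norm_nonneg _)
    _ ≤ ∑ k ∈ Finset.range s, (K * ‖v‖) * ‖x k‖ :=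
        Finset.sum_le_sum_of_subset_of_nonneg (Finset.range_mono hs) fun _ _ _ => by positivity
    _ = _ := by rw [← Finset.mul_sum]; ring

variable {S} {s : ℕ}

lemma IntegrabilityCond.zeroAtInfinity (h : S.IntegrabilityCond (fun x => S.Z x ^ 2) s) :
    S.ZeroAtInfinity := by
  have h0 : {x | S.Z x ≠ 0 ∧ S.τ x = ⊤} = ∅ := by
    ext x
    simp only [mem_ofPred_eq, mem_empty_iff_false, iff_false, not_and]
    intro hZ hτ
    have := h.2.2.1 x (pow_ne_zero 2 hZ)
    rw [hτ, top_le_iff] at this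
    exact WithTop.coe_ne_top this
  exact ⟨by rw [h0, measure_empty], fun b => by rw [h0, measure_empty]⟩

lemma IntegrabilityCond.integrable_exp_norm (h : S.IntegrabilityCond (fun x => S.Z x ^ 2) s)
    {ρ : ℝ} (hρ : 0 ≤ ρ) :
    Integrable (fun x => S.Z x ^ 2 * Real.exp (ρ * ∑ i : Fin s, ‖x i‖)) (gaussianSeq d) := by
  have hZ := S.measurable_global_Z
  have h1 : ∀ θ : Fin s → EuclideanSpace ℝ (Fin d),
      Integrable (fun x => S.Z x ^ 2 * Real.exp (∑ i, ⟪θ i, x i⟫)) (gaussianSeq d) := fun θ => by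
    refine ⟨by fun_prop, ?_⟩
    rw [hasFiniteIntegral_iff_ofReal (.of_forall fun x => by positivity)]
    simpa using h.2.2.2 θ
  refine (integrable_finsetSum Finset.univ fun (σ : Fin s × Fin d → Bool) _ => h1 fun i =>
    WithLp.toLp 2 fun j => if σ (i, j) then ρ else -ρ).mono' (by fun_prop) (.of_forall fun x => ?_)
  rw [Real.norm_of_nonneg (by positivity), ← Finset.mul_sum]
  exact mul_le_mul_of_nonneg_left (exp_sum_norm_le hρ fun i => x i) (sq_nonneg _)

/-- The bound of `‖Λ_k‖` bounds `2 G` and makes the linear coefficient at most a multiple of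
`∑_{i ≤ s} |η_i|`, all of whose exponentials are integrated by `Z²`. -/
lemma IntegrabilityCond.exists_expQuadDominated
    (h : S.IntegrabilityCond (fun x => S.Z x ^ 2) s) :
    ∃ C, ExpQuadDominated (gaussianSeq d) S.weight S.curv S.drift C := by
  obtain ⟨K, hK, hT⟩ : ∃ K : ℝ, 0 ≤ K ∧ ∀ᵐ x ∂(gaussianSeq d), S.weight x ≠ 0 →
      ∀ k < S.len x, ∀ v, ‖S.tilt v k x‖ ≤ K * ‖v‖ := by
    obtain ⟨K, hK, hle⟩ := exists_ae_le_ofReal_of_essSup_lt_top h.2.1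
    refine ⟨K, hK, hle.mono fun x hx hw k hk v => ?_⟩
    obtain ⟨hZ, hτ⟩ := S.weight_ne_zero.1 hw
    have hk' : (k : WithTop ℕ) < S.τ x := by
      rw [← S.coe_len hτ, Nat.cast_lt]
      exact hk
    have h1 := (le_iSup₂_of_le k ⟨pow_ne_zero 2 hZ, lt_top_iff_ne_top.2 hτ, hk'⟩ le_rfl).trans hx
    rw [← ofReal_norm, ENNReal.ofReal_le_ofReal_iff hK] at h1
    exact (S.Λ k x).toEuclideanLin.toContinuousLinearMap.le_of_opNorm_le h1 v
  have hlen : ∀ x, S.weight x ≠ 0 → S.len x ≤ s := fun x hw => by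
    obtain ⟨hZ, hτ⟩ := S.weight_ne_zero.1 hw
    have := h.2.2.1 x (pow_ne_zero 2 hZ)
    rwa [← S.coe_len hτ, Nat.cast_le] at this
  refine ⟨s * K ^ 2, S.stronglyMeasurable_curv.aestronglyMeasurable,
    S.measurable_drift.aestronglyMeasurable, S.curv_symm, ?_, fun R => ?_⟩
  · filter_upwards [hT] with x hx hw
    exact S.norm_curv_le (S.weight_ne_zero.1 hw).2 (hlen x hw) hK (hx hw)
  · have hm : Measurable fun x => S.weight x * Real.exp (R * ‖S.drift x‖) :=
      S.measurable_weight.mul (S.measurable_drift.norm.const_mul R).exp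
    refine (h.integrable_exp_norm (ρ := |R| * K) (by positivity)).mono'
      hm.aestronglyMeasurable ?_
    filter_upwards [hT] with x hx
    by_cases hw : S.weight x = 0
    · rw [hw, zero_mul, norm_zero]
      positivity
    · have hτ := (S.weight_ne_zero.1 hw).2
      rw [Real.norm_of_nonneg (mul_nonneg (S.weight_nonneg x) (Real.exp_pos _).le), weight,
        if_neg hτ, mul_assoc]
      have := S.norm_drift_le hτ (hlen x hw) hK (hx hw)
      gcongr
      exact le_abs_self R

variable {C : ℝ} (S)

lemma msq_lt_top (hS : S.ZeroAtInfinity)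
    (D : ExpQuadDominated (gaussianSeq d) S.weight S.curv S.drift C)
    (b : EuclideanSpace ℝ (Fin l)) : S.msq b < ⊤ := by
  rw [S.msq_eq hS]
  exact (D.integrable_exp b).lintegral_lt_top

lemma toReal_msq_eq (hS : S.ZeroAtInfinity)
    (D : ExpQuadDominated (gaussianSeq d) S.weight S.curv S.drift C) :
    (fun b => (S.msq b).toReal) = fun b =>
      ∫ x, S.weight x * Real.exp (quad (S.curv x) (S.drift x) b) ∂(gaussianSeq d) := by
  funext b
  rw [S.msq_eq hS, integral_eq_lintegral_of_nonneg_ae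
    (.of_forall fun x => mul_nonneg (S.weight_nonneg x) (Real.exp_pos _).le)
    (D.integrable_exp b).aestronglyMeasurable]

lemma lowerIntegrand_eq (x : SeqSpace d) : S.lowerIntegrand x =
    (S.weight x * Real.exp (-((1 / 2) * S.energy x))) • ((2 : ℝ) • S.G x) := by
  rw [lowerIntegrand, smul_smul, weight, energy]
  by_cases hx : S.τ x = ⊤
  · simp [G, hx]
  · rw [if_neg hx]
    congr 1
    rw [← neg_mul]
    ring

lemma M_eq : S.M = S.lowerMatrix (gaussianSeq d) S.weight id := by
  simp only [M, lowerMatrix, lowerIntegrand_eq, id]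

/-! ### The mean square estimators -/

variable {n : ℕ}

/-- The weight of the path `ω i` in the mean square estimator. -/
noncomputable def sampleWeight (b' : EuclideanSpace ℝ (Fin l)) (ω : Fin n → SeqSpace d)
    (i : Fin n) : ℝ :=
  (1 / (n : ℝ)) * (S.Z (ω i) ^ 2 * S.L b' (ω i) * if S.τ (ω i) = ⊤ then S.ε else 1)

lemma sampleWeight_nonneg (b' : EuclideanSpace ℝ (Fin l)) (ω : Fin n → SeqSpace d) (i : Fin n) :
    0 ≤ S.sampleWeight b' ω i := by
  have := S.ε_pos
  have := S.L_pos b' (ω i)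
  rw [sampleWeight]
  split_ifs <;> positivity

lemma msqEst_eq_sum (b' b : EuclideanSpace ℝ (Fin l)) (ω : Fin n → SeqSpace d) :
    S.msqEst n b' b ω =
      ∑ i, S.sampleWeight b' ω i * Real.exp (quad (S.curv (ω i)) (S.drift (ω i)) b) := by
  rw [msqEst, Finset.mul_sum]
  refine Finset.sum_congr rfl fun i _ => ?_
  rw [S.L_eq b, sampleWeight]
  ring

lemma convexOn_msqEst (b' : EuclideanSpace ℝ (Fin l)) (ω : Fin n → SeqSpace d) :
    ConvexOn ℝ univ fun b => S.msqEst n b' b ω := by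
  refine ⟨convex_univ, fun u _ v _ s t hs ht hst => ?_⟩
  simp only [msqEst_eq_sum, smul_eq_mul, Finset.mul_sum]
  rw [← Finset.sum_add_distrib]
  refine Finset.sum_le_sum fun i _ => ?_
  calc _ ≤ S.sampleWeight b' ω i * (s * Real.exp (quad (S.curv (ω i)) (S.drift (ω i)) u) +
        t * Real.exp (quad (S.curv (ω i)) (S.drift (ω i)) v)) :=
        mul_le_mul_of_nonneg_left
          (exp_quad_combo_le (S.curv_symm _) (S.curv_nonneg _) _ u v hs ht hst)
          (S.sampleWeight_nonneg b' ω i)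
    _ = _ := by ring

/-- The estimator is an integral with respect to the counting measure on the sample, for which the
conditions of differentiation under the integral sign hold trivially. -/
lemma expQuadDominated_sample (b' : EuclideanSpace ℝ (Fin l)) (ω : Fin n → SeqSpace d) :
    ExpQuadDominated Measure.count (S.sampleWeight b' ω) (fun i => S.curv (ω i))
      (fun i => S.drift (ω i)) (∑ i, ‖S.curv (ω i)‖) where
  aesm_A := (StronglyMeasurable.of_discrete).aestronglyMeasurable
  aesm_h := (StronglyMeasurable.of_discrete).aestronglyMeasurable
  symm i := S.curv_symm (ω i)
  bound := .of_forall fun i _ =>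
    Finset.single_le_sum (f := fun i => ‖S.curv (ω i)‖) (fun _ _ => norm_nonneg _)
      (Finset.mem_univ i)
  integrable _ := .of_finite

lemma exists_stronglyConvexWith_msqEst [NeZero l] (b' : EuclideanSpace ℝ (Fin l))
    {ω : Fin n → SeqSpace d} (hn : 0 < n) (hr : S.r n ω) :
    ∃ m : ℝ, StronglyConvexWith m fun b => S.msqEst n b' b ω := by
  have D := S.expQuadDominated_sample b' ω
  have hω : Measurable ω := .of_discrete
  have hf : (fun b => S.msqEst n b' b ω) = fun b => ∫ i, S.sampleWeight b' ω i *
      Real.exp (quad (S.curv (ω i)) (S.drift (ω i)) b) ∂Measure.count := by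
    funext b
    rw [msqEst_eq_sum, integral_count]
  have hM : (S.lowerMatrix Measure.count (S.sampleWeight b' ω) ω).PosDef := by
    refine S.posDef_lowerMatrix D hω (S.sampleWeight_nonneg b' ω) fun v hv => ?_
    obtain ⟨i, hi⟩ := hr v hv
    obtain ⟨h1, h2, h3⟩ := (S.mem_A_iff v _).1 hi
    refine Measure.count_ne_zero ⟨i, ?_, h3⟩
    have := S.L_pos b' (ω i)
    have hn' : (0 : ℝ) < n := by exact_mod_cast hn
    rw [sampleWeight, if_neg h2]
    positivity
  rw [hf]
  obtain ⟨m, -, hm⟩ := exists_stronglyConvexWith hM D.twiceDifferentiable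
    (S.posSemidef_hessian_sub_lowerMatrix D hω (S.sampleWeight_nonneg b' ω))
  exact ⟨m, hm⟩

lemma exists_msqEst_add_smul (b' : EuclideanSpace ℝ (Fin l)) {ω : Fin n → SeqSpace d}
    (hr : ¬ S.r n ω) :
    ∃ b : EuclideanSpace ℝ (Fin l), b ≠ 0 ∧ ∀ (a : EuclideanSpace ℝ (Fin l)) (t : ℝ),
      S.msqEst n b' (a + t • b) ω = S.msqEst n b' a ω := by
  simp only [r, not_forall, not_exists] at hr
  obtain ⟨b, hb, h⟩ := hr
  refine ⟨b, hb, fun a t => ?_⟩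
  rw [msqEst, msqEst]
  congr 1
  refine Finset.sum_congr rfl fun i _ => ?_
  by_cases hZ : S.Z (ω i) = 0
  · simp [hZ]
  have h0 : ⟪S.curv (ω i) b, b⟫ = 0 := by
    by_cases hτ : S.τ (ω i) = ⊤
    · simp [S.curv_of_top hτ]
    · have hi := h i
      rw [S.mem_A_iff] at hi
      exact le_antisymm (not_lt.1 fun hpos => hi ⟨hZ, hτ, hpos⟩) (S.curv_nonneg _ b)
  rw [S.L_eq (a + t • b), S.L_eq a, S.quad_add_smul h0]

end LETGS.Setting

theorem mainTheorem6 {d l : ℕ} [NeZero d] [NeZero l] (S : Setting d l) :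
    -- the mean square under the integrability and the linear independence conditions
    (∀ s : ℕ, S.IntegrabilityCond (fun x => S.Z x ^ 2) s → S.LinIndepCond →
      (∀ i j, Integrable (fun x => S.lowerIntegrand x i j) (gaussianSeq d)) ∧
      S.M.PosDef ∧
      (∀ b, S.msq b < ⊤) ∧
      TwiceDifferentiable (fun b => (S.msq b).toReal) ∧
      (∀ b, (hessian (fun b => (S.msq b).toReal) b - S.M).PosSemidef) ∧
      (∃ m : ℝ, IsLeast (spectrum ℝ S.M) m ∧
        StronglyConvexWith m (fun b => (S.msq b).toReal)) ∧
      (∃! b₀, ∀ b, S.msq b₀ ≤ S.msq b)) ∧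
    -- the well-known mean square estimators
    (∀ (n : ℕ) (b' : EuclideanSpace ℝ (Fin l)) (ω : Fin n → SeqSpace d), 0 < n →
      ConvexOn ℝ univ (fun b => S.msqEst n b' b ω) ∧
      (S.r n ω → ∃ m : ℝ, StronglyConvexWith m (fun b => S.msqEst n b' b ω)) ∧
      (¬ S.r n ω → ∃ b : EuclideanSpace ℝ (Fin l), b ≠ 0 ∧
        ∀ (a : EuclideanSpace ℝ (Fin l)) (t : ℝ),
          S.msqEst n b' (a + t • b) ω = S.msqEst n b' a ω)) ∧
    -- the mean square when `Z` vanishes almost surely on `τ = ∞`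
    (S.ZeroAtInfinity →
      ((∃ b, S.msq b < ⊤) →
        (finiteSet S.msq).Nonempty ∧
        ConvexOn ℝ (finiteSet S.msq) (fun b => (S.msq b).toReal) ∧
        (S.LinIndepCond → StrictCond S.msq ∧
          ∃ b₀, S.msq b₀ < ⊤ ∧ ∀ b, b ≠ b₀ → S.msq b₀ < S.msq b)) ∧
      (¬ S.LinIndepCond → ∃ b : EuclideanSpace ℝ (Fin l), b ≠ 0 ∧
        ∀ (a : EuclideanSpace ℝ (Fin l)) (t : ℝ), S.msq (a + t • b) = S.msq a)) := by
  refine ⟨fun s hI hC => ?_, fun n b' ω hn => ⟨S.convexOn_msqEst b' ω,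
    S.exists_stronglyConvexWith_msqEst b' hn, S.exists_msqEst_add_smul b'⟩,
    fun hS => ⟨fun hfin => ⟨hfin, S.convexOn_toReal_msq hS, fun hC =>
      ⟨S.strictCond_msq hS hC hfin, S.exists_unique_min_msq hS hC hfin⟩⟩,
      S.exists_msq_add_smul hS⟩⟩
  have hS := hI.zeroAtInfinity
  obtain ⟨C, D⟩ := hI.exists_expQuadDominated
  have hM : S.M.PosDef := by
    rw [S.M_eq]
    refine S.posDef_lowerMatrix D measurable_id S.weight_nonneg fun v hv h0 =>
      (hC v hv).ne' (measure_mono_null (fun x hx => ?_) h0)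
    obtain ⟨h1, h2, h3⟩ := (S.mem_A_iff v x).1 hx
    exact ⟨S.weight_ne_zero.2 ⟨h1, h2⟩, h3⟩
  have hf : TwiceDifferentiable fun b => (S.msq b).toReal := by
    rw [S.toReal_msq_eq hS D]
    exact D.twiceDifferentiable
  have hle : ∀ b, (hessian (fun b => (S.msq b).toReal) b - S.M).PosSemidef := by
    rw [S.toReal_msq_eq hS D, S.M_eq]
    exact S.posSemidef_hessian_sub_lowerMatrix D measurable_id S.weight_nonneg
  refine ⟨fun i j => ?_, hM, S.msq_lt_top hS D, hf, hle, exists_stronglyConvexWith hM hf hle, ?_⟩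
  · simp only [S.lowerIntegrand_eq]
    exact S.integrable_lowerMatrix_entry D measurable_id i j
  · obtain ⟨b₀, -, hmin⟩ := S.exists_unique_min_msq hS hC ⟨0, S.msq_lt_top hS D 0⟩
    refine ⟨b₀, fun b => ?_, fun c hc => ?_⟩
    · rcases eq_or_ne b b₀ with rfl | hb
      · exact le_rfl
      · exact (hmin b hb).le
    · by_contra hne
      exact absurd (hc b₀) (hmin c hne).not_ge
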